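/- Let $F_n=A_1*\cdots*A_k*B$ be a free group of rank $n$, where $A_j$ is free with basis $y^j_1,\dots,y^j_{s(j)}$ and $B$ is free with basis $x_1,\dots,x_m$, $m=n-\sum_{j=1}^k s(j)$. An $(\mathcal A*B)$-tree is an $\mathbb R$-tree with an isometric action of $F_n$ in which every $A_j$ fixes a point. A finite subtree of $T$ is the convex hull of a nonempty finite set. An $(\mathcal A*B)$-tree $T$ is *geometric* if there is a finite subtree $K\subset T$ with $K\cap gK\ne\emptyset$ for every $g\in\mathcal S:=\{x_1,\dots,x_m\}\cup A_1\cup\dots\cup A_k$, such that every $F_n$-orbit of $T$ meets $K$ and such that the following universal property holds: for every $\mathbb R$-tree $T'$ with an isometric $F_n$-action and every isometric embedding $\iota:K\to T'$ with $g\,\iota(p)=\iota(gp)$ whenever $g\in\mathcal S$ and $p,gp\in K$, there is a unique $F_n$-equivariant morphism $f:T\to T'$ with $f|_K=\iota$. Here a morphism is a map such that every segment of $T$ is a finite union of subsegments on each of which the map is isometric. The directions at $x\in T$ are the components of $T\setminus\{x\}$, and $x$ is a branch point if it has at least three directions. The action is *without inversions* if no $g\in F_n$ fixes a point that is not a branch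 point while interchanging two directions at it. It is *minimal* if $T$ has no proper nonempty invariant subtree, and *nontrivial* if no point is fixed by all of $F_n$. Let $l(g)=\inf_{x\in T}d(x,gx)$, let $L\subset\mathbb R$ be the subgroup generated by the numbers $l(g)$, $g\in F_n$, and let $r(T)=\dim_{\mathbb Q}(L\otimes_{\mathbb Z}\mathbb Q)$. Let $T$ be a geometric minimal $(\mathcal A*B)$-tree without inversions, not isometric to $\mathbb R$ and with nontrivial action, and let $b\in\{0,1,2,\dots\}\cup\{\infty\}$ be the number of orbits of branch points of $T$. Then $$r(T)\le n-\sum_{j=1}^k s(j)+b-1 .$$ (If $b=\infty$, nothing is asserted.) -/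

import Mathlib

universe u v

namespace RelTree

/-! ### Real trees -/

section Metric

variable {X : Type u} [MetricSpace X]

/-- `s` is an arc from `x` to `y`: the image of a continuous injective path on `[0,1]`. -/
def IsArc (x y : X) (s : Set X) : Prop :=
  ∃ γ : ℝ → X, ContinuousOn γ (Set.Icc 0 1) ∧ Set.InjOn γ (Set.Icc 0 1) ∧
    γ 0 = x ∧ γ 1 = y ∧ γ '' Set.Icc 0 1 = s

/-- `s` is a geodesic segment from `x` to `y`: the image of an isometric embedding of the
interval `[0, dist x y]` that starts at `x` and ends at `y`. -/
def IsGeodesicSegment (x y : X) (s : Set X) : Prop :=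
  ∃ γ : ℝ → X, γ 0 = x ∧ γ (dist x y) = y ∧
    (∀ a ∈ Set.Icc 0 (dist x y), ∀ b ∈ Set.Icc 0 (dist x y), dist (γ a) (γ b) = |a - b|) ∧
    γ '' Set.Icc 0 (dist x y) = s

variable (X) in
/-- A (nonempty) metric space is an `ℝ`-tree if any two distinct points are joined by a unique
arc, and this arc is a geodesic segment. -/
def IsRTree : Prop :=
  Nonempty X ∧ ∀ x y : X, x ≠ y →
    (∃! s : Set X, IsArc x y s) ∧ ∀ s : Set X, IsArc x y s → IsGeodesicSegment x y s

/-- The points lying between `x` and `y`; in an `ℝ`-tree this is the geodesic segment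
from `x` to `y`. -/
def seg (x y : X) : Set X := {z | dist x z + dist z y = dist x y}

/-- A subtree: a nonempty subset containing the segment between any two of its points. -/
def IsSubtree (S : Set X) : Prop :=
  S.Nonempty ∧ ∀ x ∈ S, ∀ y ∈ S, seg x y ⊆ S

/-- A finite subtree: the convex hull of a nonempty finite set of points. -/
def IsFiniteSubtree (K : Set X) : Prop :=
  ∃ P : Set X, P.Finite ∧ P.Nonempty ∧ K = ⋂₀ {S : Set X | IsSubtree S ∧ P ⊆ S}

/-- The directions at `x`: the connected components of the complement of `x`. -/
def directions (x : X) : Set (Set X) :=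
  {d | ∃ y : X, y ≠ x ∧ d = connectedComponentIn {x}ᶜ y}

/-- A branch point is a point with at least three directions. -/
def IsBranchPoint (x : X) : Prop := 3 ≤ (directions x).encard

/-- A morphism of `ℝ`-trees: every segment is a finite union of subsegments, each of which is
mapped isometrically. -/
def IsMorphism {Y : Type u} [MetricSpace Y] (f : X → Y) : Prop :=
  ∀ x y : X, ∃ C : Set (X × X), C.Finite ∧ seg x y = ⋃ p ∈ C, seg p.1 p.2 ∧
    ∀ p ∈ C, ∀ z ∈ seg p.1 p.2, ∀ w ∈ seg p.1 p.2, dist (f z) (f w) = dist z w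

end Metric

/-! ### Group actions on real trees -/

section Action

variable (F : Type v) [Group F] (T : Type u) [MetricSpace T] [MulAction F T]

/-- No point of `T` is fixed by the whole group. -/
def IsNontrivialAction : Prop := ¬ ∃ x : T, ∀ g : F, g • x = x

/-- There is no proper invariant subtree. -/
def IsMinimalAction : Prop :=
  ∀ S : Set T, IsSubtree S → (∀ g : F, ∀ x ∈ S, g • x ∈ S) → S = Set.univ

/-- No group element fixes a point that is not a branch point while interchanging two
directions at that point. -/
def HasNoInversions : Prop :=
  ¬ ∃ (g : F) (x : T), ¬ IsBranchPoint x ∧ g • x = x ∧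
    ∃ d₁ ∈ directions x, ∃ d₂ ∈ directions x, d₁ ≠ d₂ ∧
      (fun y => g • y) '' d₁ = d₂ ∧ (fun y => g • y) '' d₂ = d₁

variable {F} in
/-- The translation length of `g` on `T`. -/
noncomputable def translationLength (g : F) : ℝ := ⨅ x : T, dist x (g • x)

/-- The subgroup `L` of `ℝ` generated by the values of the translation length function. -/
noncomputable def lengthGroup : AddSubgroup ℝ :=
  AddSubgroup.closure (Set.range fun g : F => translationLength T g)

/-- The `ℚ`-rank of `T`: the dimension of the `ℚ`-vector space `ℚ ⊗ L` (`⊤` if infinite). -/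
noncomputable def qRank : ℕ∞ :=
  Cardinal.toENat (Module.rank ℚ (TensorProduct ℤ ℚ (lengthGroup F T)))

/-- The number of orbits of branch points (`⊤` if infinite). -/
noncomputable def numBranchOrbits : ℕ∞ :=
  {O : Set T | ∃ x : T, IsBranchPoint x ∧ O = MulAction.orbit F x}.encard

end Action

/-! ### Trees relative to a system of free factors -/

section Relative

variable {k m : ℕ} {s : Fin k → ℕ} {F : Type v} [Group F]

/-- The free factor `A_j`, generated by the `j`-th block of the basis. -/
def factor (e : FreeGroupBasis ((Σ j : Fin k, Fin (s j)) ⊕ Fin m) F) (j : Fin k) :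
    Subgroup F :=
  Subgroup.closure (Set.range fun i : Fin (s j) => e (Sum.inl ⟨j, i⟩))

/-- The group elements whose restrictions make up a system: the basis elements `x_i` of `B` and
all the elements of the free factors `A_j`. -/
def systemElements (e : FreeGroupBasis ((Σ j : Fin k, Fin (s j)) ⊕ Fin m) F) : Set F :=
  {g | (∃ i : Fin m, g = e (Sum.inr i)) ∨ ∃ j : Fin k, g ∈ factor e j}

variable (T : Type u) [MetricSpace T] [MulAction F T]

/-- An `(A_1 * ⋯ * A_k * B)`-tree with special points: an `ℝ`-tree on which every `A_j`
is elliptic. The action is isometric by a type class assumption. -/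
def IsRelativeTree (e : FreeGroupBasis ((Σ j : Fin k, Fin (s j)) ⊕ Fin m) F) : Prop :=
  IsRTree T ∧ ∀ j : Fin k, ∃ p : T, ∀ a ∈ factor e j, a • p = p

variable {T}

/-- `ι` embeds `K ⊆ T` isometrically in `T'`, and every element `g` in `S` acts on the image
of `K ∩ g⁻¹ K` as it does in `T`. -/
def Realizes (S : Set F) (K : Set T) {T' : Type u} [MetricSpace T'] [MulAction F T']
    (ι : K → T') : Prop :=
  Isometry ι ∧ ∀ g ∈ S, ∀ p q : K, g • (p : T) = (q : T) → g • ι p = ι q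

/-- `T` is the tree `T_𝒦` of the system given by restricting the elements of `S` to `K ⊆ T`:
every orbit meets `K`, and for every tree `T'` that contains `K` isometrically and in which the
elements of `S` extend the same partial isometries of `K`, there is a unique equivariant morphism
from `T` to `T'` that is the identity on `K`. -/
def IsTreeOfSystem (S : Set F) (K : Set T) : Prop :=
  (∀ x : T, ∃ g : F, g • x ∈ K) ∧
  ∀ (T' : Type u) [MetricSpace T'] [MulAction F T'] [IsIsometricSMul F T'], IsRTree T' →
    ∀ ι : K → T', Realizes S K ι →
      ∃! f : T → T', IsMorphism f ∧ (∀ (g : F) (x : T), f (g • x) = g • f x) ∧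
        ∀ p : K, f p = ι p

variable (T) in
/-- `T` is geometric: it is the tree of the system given by some finite subtree `K` that meets
its translates by the `x_i` and by the elements of the `A_j`. -/
def IsGeometric (e : FreeGroupBasis ((Σ j : Fin k, Fin (s j)) ⊕ Fin m) F) : Prop :=
  ∃ K : Set T, IsFiniteSubtree K ∧
    (∀ g ∈ systemElements e, (K ∩ (fun x => g • x) '' K).Nonempty) ∧
    IsTreeOfSystem (systemElements e) K

end Relative

end RelTree

/-! Let Λ be `branchGroup T`, the group generated by the distances between branch points. It
contains all translation lengths, since for a branch point x the length of g is 0 or d(x,g²x) −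
d(x,gx). The median of three branch points is a branch point, so d(v,u) ≡ d(v,w) + d(w,u) mod 2Λ
(`exists_dist_add_dist`). Hence, for a fixed branch point v₀, Λ/2Λ is generated by the distances
from v₀ to representatives of the other b − 1 orbits and by the numbers d(v₀,gv₀), g in the basis of
F. A basis element of A_j is elliptic; without inversions it moves v₀ by twice the distance to a
branch point (`exists_half_dist_of_fixed`) and contributes nothing. Only the m elements x_i remain,
so m + b − 1 generators suffice for Λ/2Λ. If Λ is finitely generated, Nakayama's lemma at 2 turns
this into the bound on the rank (`toENat_rank_le`).

Finite generation, for finite b, is where geometricity enters. For a finite set V let D be the set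
of points of K whose distances to V lie in the group generated by half the distances within V. For a
suitable V, D is preserved by the partial isometries of K coming from each A_j and each ⟨x_i⟩
(`exists_block_coordSet`). In a geometric tree every g taking a point of K into K acts on it as a
chain of such partial isometries (`IsTreeOfSystem.smul_mem`): copies of K indexed by the free
product are glued to another tree, in which points of K are identified only by chains
(`exists_amalgam`), and the universal property maps T to that tree. So D is preserved by all of F
within K, and induction on word length puts the distances between branch points into a finitely
generated group (`branchGroup_le_coordGroup`).

A branch point exists because a tree without one embeds in the line, where the action would have an
axis filling the line or a global fixed point (`exists_isBranchPoint`). -/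

namespace RelTree

/-! ### Gromov products and the metric characterization of real trees -/

section GromovProduct

variable {X : Type*} [PseudoMetricSpace X]

/-- The Gromov product of `x` and `y` at `o`. -/
noncomputable def gp (o x y : X) : ℝ := (dist o x + dist o y - dist x y) / 2

/-- The metric axioms of a real tree: any two points are joined by points at every intermediate
distance, and Gromov products satisfy the ultrametric inequality. -/
structure IsTreeMetric (X : Type*) [PseudoMetricSpace X] : Prop where
  exists_between : ∀ (x y : X) (t : ℝ), 0 ≤ t → t ≤ dist x y →
    ∃ z : X, dist x z = t ∧ dist z y = dist x y - t
  hyp : ∀ o x y z : X, gp o x y ≤ gp o x z ∨ gp o y z ≤ gp o x z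

theorem gp_comm (o x y : X) : gp o x y = gp o y x := by
  unfold gp; rw [dist_comm x y]; ring

theorem gp_nonneg (o x y : X) : 0 ≤ gp o x y := by
  unfold gp; have := dist_triangle_left x y o; linarith

theorem gp_le_left (o x y : X) : gp o x y ≤ dist o x := by
  unfold gp; have := dist_triangle o x y; linarith

theorem gp_le_right (o x y : X) : gp o x y ≤ dist o y := by
  rw [gp_comm]; exact gp_le_left o y x

theorem dist_eq_sub_gp (o x y : X) : dist x y = dist o x + dist o y - 2 * gp o x y := by
  unfold gp; ring

theorem gp_eq_left_iff {o x y : X} : gp o x y = dist o x ↔ dist o x + dist x y = dist o y := by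
  unfold gp; constructor <;> intro h <;> linarith

theorem gp_eq_zero_iff {o x y : X} : gp o x y = 0 ↔ dist x o + dist o y = dist x y := by
  unfold gp; rw [dist_comm o x]; constructor <;> intro h <;> linarith

theorem le_gp (hX : IsTreeMetric X) {o x y z : X} {r : ℝ} (h₁ : r ≤ gp o x y)
    (h₂ : r ≤ gp o y z) : r ≤ gp o x z := by
  rcases hX.hyp o x y z with h | h
  · exact h₁.trans h
  · exact h₂.trans h

theorem gp_isometry {Y : Type*} [PseudoMetricSpace Y] {f : X → Y} (hf : Isometry f) (o x y : X) :
    gp (f o) (f x) (f y) = gp o x y := by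
  simp only [gp, hf.dist_eq]

/-- The Gromov product with a point of a segment issuing from the base point. -/
theorem gp_of_between (hX : IsTreeMetric X) {e y f : X} (h : dist e y + dist y f = dist e f)
    (v : X) : gp e y v = min (dist e y) (gp e f v) := by
  have h1 : gp e y f = dist e y := gp_eq_left_iff.2 h
  apply le_antisymm
  · refine le_min (gp_le_left _ _ _) (le_gp hX (y := y) ?_ le_rfl)
    rw [gp_comm e f y, h1]; exact gp_le_left _ _ _
  · exact le_gp hX (y := f) (h1.symm ▸ min_le_left _ _) (min_le_right _ _)

/-- Take the point of the segment from `x` to `y` at distance `gp x y z` from `x`; the ultrametric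
inequality puts it on the segment to `z` as well, and the third equality is then arithmetic. -/
theorem exists_median (hX : IsTreeMetric X) (x y z : X) :
    ∃ c, dist x c = gp x y z ∧ dist x c + dist c y = dist x y ∧ dist x c + dist c z = dist x z ∧
      dist y c + dist c z = dist y z := by
  obtain ⟨c, hc, hcy⟩ := hX.exists_between x y (gp x y z) (gp_nonneg _ _ _) (gp_le_left _ _ _)
  have h1 : gp x c y = gp x y z := by
    rw [← hc]; exact gp_eq_left_iff.2 (by rw [hc, hcy]; ring)
  have h2 : gp x c z = dist x c :=
    le_antisymm (gp_le_left _ _ _) (hc ▸ le_gp hX (y := y) h1.ge le_rfl)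
  rw [gp_eq_left_iff] at h2
  refine ⟨c, hc, by rw [hc, hcy]; ring, h2, ?_⟩
  have h3 := dist_eq_sub_gp x y z
  rw [dist_comm y c]
  linarith

/-- If `z` and `w` lie on a segment, their distance is the difference of their positions. -/
theorem dist_of_between (hX : IsTreeMetric X) {x y z w : X} (hz : dist x z + dist z y = dist x y)
    (hw : dist x w + dist w y = dist x y) : dist z w = |dist x z - dist x w| := by
  have h1 := gp_of_between hX hz w
  rw [gp_comm x y w, gp_eq_left_iff.2 hw] at h1
  have h2 := dist_eq_sub_gp x z w
  rw [h2, h1]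
  rcases le_total (dist x z) (dist x w) with h | h
  · rw [min_eq_left h, abs_of_nonpos (by linarith)]; ring
  · rw [min_eq_right h, abs_of_nonneg (by linarith)]; ring

end GromovProduct

/-! ### Real trees satisfy the metric axioms. -/

section ArcConstruction

variable {X : Type u} [MetricSpace X]

/-- A path with unit speed is an arc. -/
theorem isArc_of_unitSpeed {a b : ℝ} (hab : a < b) {δ : ℝ → X}
    (hinj : Set.InjOn δ (Set.Icc a b))
    (hlip : ∀ s ∈ Set.Icc a b, ∀ t ∈ Set.Icc a b, dist (δ s) (δ t) ≤ |s - t|) :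
    IsArc (δ a) (δ b) (δ '' Set.Icc a b) := by
  have hmap : ∀ r ∈ Set.Icc (0 : ℝ) 1, a + (b - a) * r ∈ Set.Icc a b := by
    rintro r ⟨h0, h1⟩
    constructor <;> nlinarith
  have hcont : ContinuousOn δ (Set.Icc a b) := by
    have : LipschitzOnWith 1 δ (Set.Icc a b) := by
      apply LipschitzOnWith.of_dist_le_mul
      intro s hs t ht
      simpa [Real.dist_eq] using hlip s hs t ht
    exact this.continuousOn
  refine ⟨fun r => δ (a + (b - a) * r), ?_, ?_, by simp, by simp, ?_⟩
  · exact hcont.comp (by fun_prop) hmap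
  · intro r hr r' hr' h
    have := hinj (hmap r hr) (hmap r' hr') h
    have hba : b - a ≠ 0 := by linarith
    exact mul_left_cancel₀ hba (by linarith)
  · ext z
    constructor
    · rintro ⟨r, hr, rfl⟩
      exact ⟨_, hmap r hr, rfl⟩
    · rintro ⟨s, hs, rfl⟩
      have hba : 0 < b - a := by linarith
      refine ⟨(s - a) / (b - a), ⟨div_nonneg (by linarith [hs.1]) hba.le, ?_⟩, ?_⟩
      · rw [div_le_one hba]; linarith [hs.2]
      · have : a + (b - a) * ((s - a) / (b - a)) = s := by field_simp; ring
        simp only [this]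

/-- `α` is an isometric path of length `a` from `x` to `y`. -/
def IsGeodesicPath (x y : X) (a : ℝ) (α : ℝ → X) : Prop :=
  0 ≤ a ∧ α 0 = x ∧ α a = y ∧ ∀ s ∈ Set.Icc 0 a, ∀ t ∈ Set.Icc 0 a, dist (α s) (α t) = |s - t|

theorem IsGeodesicPath.dist_left {x y : X} {a : ℝ} {α : ℝ → X} (h : IsGeodesicPath x y a α)
    {t : ℝ} (ht : t ∈ Set.Icc 0 a) : dist x (α t) = t := by
  have := h.2.2.2 0 ⟨le_rfl, h.1⟩ t ht
  rw [h.2.1] at this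
  rw [this, zero_sub, abs_neg, abs_of_nonneg ht.1]

theorem IsGeodesicPath.dist_right {x y : X} {a : ℝ} {α : ℝ → X} (h : IsGeodesicPath x y a α)
    {t : ℝ} (ht : t ∈ Set.Icc 0 a) : dist (α t) y = a - t := by
  have := h.2.2.2 t ht a ⟨h.1, le_rfl⟩
  rw [h.2.2.1] at this
  rw [this, abs_sub_comm, abs_of_nonneg (by linarith [ht.2])]

theorem IsGeodesicPath.length_eq {x y : X} {a : ℝ} {α : ℝ → X} (h : IsGeodesicPath x y a α) :
    dist x y = a := by
  have := h.dist_left ⟨h.1, le_rfl⟩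
  rwa [h.2.2.1] at this

theorem IsGeodesicPath.isArc {x y : X} {a : ℝ} {α : ℝ → X} (h : IsGeodesicPath x y a α)
    (ha : 0 < a) : IsArc x y (α '' Set.Icc 0 a) := by
  have := isArc_of_unitSpeed ha (δ := α) ?_ fun s hs t ht => (h.2.2.2 s hs t ht).le
  · rwa [h.2.1, h.2.2.1] at this
  · intro s hs t ht hst
    have := h.2.2.2 s hs t ht
    rw [hst, dist_self] at this
    linarith [abs_eq_zero.1 this.symm]

theorem IsGeodesicPath.restrict {x y : X} {a : ℝ} {α : ℝ → X} (h : IsGeodesicPath x y a α)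
    {t : ℝ} (ht : t ∈ Set.Icc 0 a) : IsGeodesicPath x (α t) t α :=
  ⟨ht.1, h.2.1, rfl, fun s hs s' hs' =>
    h.2.2.2 s ⟨hs.1, hs.2.trans ht.2⟩ s' ⟨hs'.1, hs'.2.trans ht.2⟩⟩

theorem IsGeodesicPath.drop {x y : X} {a : ℝ} {α : ℝ → X} (h : IsGeodesicPath x y a α)
    {t : ℝ} (ht : t ∈ Set.Icc 0 a) : IsGeodesicPath (α t) y (a - t) fun s => α (t + s) := by
  refine ⟨by linarith [ht.2], by simp, by simpa using h.2.2.1, fun s hs s' hs' => ?_⟩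
  have := h.2.2.2 (t + s) ⟨by linarith [ht.1, hs.1], by linarith [hs.2]⟩ (t + s')
    ⟨by linarith [ht.1, hs'.1], by linarith [hs'.2]⟩
  rw [this]; congr 1; ring

theorem IsRTree.exists_geodesicPath (hX : IsRTree X) (x y : X) :
    ∃ α, IsGeodesicPath x y (dist x y) α := by
  rcases eq_or_ne x y with rfl | hxy
  · refine ⟨fun _ => x, by simp, rfl, rfl, fun s hs t ht => ?_⟩
    simp only [dist_self, Set.Icc_self, Set.mem_singleton_iff] at hs ht
    simp [hs, ht]
  · obtain ⟨s, hs, -⟩ := (hX.2 x y hxy).1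
    obtain ⟨γ, h0, h1, h2, -⟩ := (hX.2 x y hxy).2 s hs
    exact ⟨γ, dist_nonneg, h0, h1, h2⟩

/-- Two geodesic paths that meet only in their common origin fit together to a geodesic. -/
theorem IsRTree.dist_eq_add_of_disjoint (hX : IsRTree X) {c y z : X} {a b : ℝ} {α β : ℝ → X}
    (hα : IsGeodesicPath c y a α) (hβ : IsGeodesicPath c z b β)
    (hd : ∀ s ∈ Set.Icc 0 a, ∀ t ∈ Set.Icc 0 b, α s = β t → s = 0) :
    dist y z = a + b := by
  have hd' : ∀ s ∈ Set.Icc 0 a, ∀ t ∈ Set.Icc 0 b, α s = β t → s = 0 ∧ t = 0 := by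
    intro s hs t ht h
    have h0 := hd s hs t ht h
    refine ⟨h0, ?_⟩
    have h1 := hβ.dist_left ht
    rw [← h, h0, hα.2.1, dist_self] at h1
    exact h1.symm
  rcases hα.1.eq_or_lt with ha | ha
  · have h1 := hα.length_eq
    rw [← ha, dist_eq_zero] at h1
    rw [← h1, hβ.length_eq, ← ha, zero_add]
  rcases hβ.1.eq_or_lt with hb | hb
  · have h1 := hβ.length_eq
    rw [← hb, dist_eq_zero] at h1
    rw [← h1, dist_comm, hα.length_eq, ← hb, add_zero]
  classical
  -- The first path reversed, followed by the second, is injective and 1-Lipschitz, hence an arc; in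
  -- a real tree this arc is a geodesic, and it passes through `c`.
  let δ : ℝ → X := fun s => if s ≤ 0 then α (-s) else β s
  have hneg : ∀ s, s ≤ 0 → δ s = α (-s) := fun s hs => if_pos hs
  have hpos : ∀ s, 0 < s → δ s = β s := fun s hs => if_neg (not_le.2 hs)
  have hab : -a < b := by linarith
  have hmix : ∀ s ∈ Set.Icc (-a) b, ∀ t ∈ Set.Icc (-a) b, s ≤ 0 → 0 < t →
      dist (δ s) (δ t) ≤ |s - t| := by
    intro s hs t ht h1 h2
    rw [hneg s h1, hpos t h2]
    have e1 := hα.dist_left (t := -s) ⟨by linarith, by linarith [hs.1]⟩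
    have e2 := hβ.dist_left (t := t) ⟨h2.le, ht.2⟩
    have := dist_triangle_left (α (-s)) (β t) c
    rw [abs_of_neg (by linarith)]; linarith
  have hlip : ∀ s ∈ Set.Icc (-a) b, ∀ t ∈ Set.Icc (-a) b, dist (δ s) (δ t) ≤ |s - t| := by
    intro s hs t ht
    rcases le_or_gt s 0 with h1 | h1 <;> rcases le_or_gt t 0 with h2 | h2
    · rw [hneg s h1, hneg t h2, hα.2.2.2 _ ⟨by linarith, by linarith [hs.1]⟩ _
        ⟨by linarith, by linarith [ht.1]⟩, ← abs_neg]
      apply le_of_eq; congr 1; ring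
    · exact hmix s hs t ht h1 h2
    · rw [dist_comm, abs_sub_comm]; exact hmix t ht s hs h2 h1
    · rw [hpos s h1, hpos t h2]
      exact (hβ.2.2.2 _ ⟨h1.le, hs.2⟩ _ ⟨h2.le, ht.2⟩).le
  have hmixne : ∀ s ∈ Set.Icc (-a) b, ∀ t ∈ Set.Icc (-a) b, s ≤ 0 → 0 < t → δ s ≠ δ t := by
    intro s hs t ht h1 h2 h
    rw [hneg s h1, hpos t h2] at h
    have := (hd' (-s) ⟨by linarith, by linarith [hs.1]⟩ t ⟨h2.le, ht.2⟩ h).2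
    linarith
  have hinj : Set.InjOn δ (Set.Icc (-a) b) := by
    intro s hs t ht h
    rcases le_or_gt s 0 with h1 | h1 <;> rcases le_or_gt t 0 with h2 | h2
    · rw [hneg s h1, hneg t h2] at h
      have := hα.2.2.2 (-s) ⟨by linarith, by linarith [hs.1]⟩ (-t)
        ⟨by linarith, by linarith [ht.1]⟩
      rw [h, dist_self] at this
      linarith [abs_eq_zero.1 this.symm]
    · exact absurd h (hmixne s hs t ht h1 h2)
    · exact absurd h.symm (hmixne t ht s hs h2 h1)
    · rw [hpos s h1, hpos t h2] at h
      have := hβ.2.2.2 s ⟨h1.le, hs.2⟩ t ⟨h2.le, ht.2⟩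
      rw [h, dist_self] at this
      linarith [abs_eq_zero.1 this.symm]
  have harc := isArc_of_unitSpeed hab hinj hlip
  have e1 : δ (-a) = y := by rw [hneg _ (by linarith), neg_neg, hα.2.2.1]
  have e2 : δ b = z := by rw [hpos _ hb, hβ.2.2.1]
  have e0 : δ 0 = c := by rw [hneg _ le_rfl, neg_zero, hα.2.1]
  have hyz : y ≠ z := by
    rw [← e1, ← e2]
    exact hmixne _ ⟨le_rfl, hab.le⟩ _ ⟨hab.le, le_rfl⟩ (by linarith) hb
  rw [e1, e2] at harc
  obtain ⟨γ, g0, g1, g2, g3⟩ := (hX.2 y z hyz).2 _ harc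
  have hγ : IsGeodesicPath y z (dist y z) γ := ⟨dist_nonneg, g0, g1, g2⟩
  have hc : c ∈ γ '' Set.Icc 0 (dist y z) := by
    rw [g3]; exact ⟨0, ⟨by linarith, hb.le⟩, e0⟩
  obtain ⟨t, ht, rfl⟩ := hc
  have h1 := hγ.dist_left ht
  have h2 := hγ.dist_right ht
  have h3 := hα.length_eq
  have h4 := hβ.length_eq
  rw [dist_comm] at h3
  linarith

/-- Two geodesic paths with the same origin agree up to the Gromov product of their ends. -/
theorem IsRTree.geodesicPath_agree (hX : IsRTree X) {x y z : X} {α β : ℝ → X}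
    (hα : IsGeodesicPath x y (dist x y) α) (hβ : IsGeodesicPath x z (dist x z) β)
    {t : ℝ} (ht : 0 ≤ t) (htg : t ≤ gp x y z) : α t = β t := by
  set m := min (dist x y) (dist x z)
  have hm : 0 ≤ m := le_min dist_nonneg dist_nonneg
  have hcα : ContinuousOn α (Set.Icc 0 m) := by
    have : LipschitzOnWith 1 α (Set.Icc 0 m) := by
      apply LipschitzOnWith.of_dist_le_mul
      intro s hs t ht
      simpa [Real.dist_eq] using (hα.2.2.2 s ⟨hs.1, hs.2.trans (min_le_left _ _)⟩ t
        ⟨ht.1, ht.2.trans (min_le_left _ _)⟩).le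
    exact this.continuousOn
  have hcβ : ContinuousOn β (Set.Icc 0 m) := by
    have : LipschitzOnWith 1 β (Set.Icc 0 m) := by
      apply LipschitzOnWith.of_dist_le_mul
      intro s hs t ht
      simpa [Real.dist_eq] using (hβ.2.2.2 s ⟨hs.1, hs.2.trans (min_le_right _ _)⟩ t
        ⟨ht.1, ht.2.trans (min_le_right _ _)⟩).le
    exact this.continuousOn
  -- The last parameter `t₀` at which the paths agree is the Gromov product: after it they are
  -- disjoint and concatenate to a geodesic from `y` to `z`.
  let A : Set ℝ := {s | s ∈ Set.Icc 0 m ∧ dist (α s) (β s) = 0}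
  have hAclosed : IsClosed A := by
    have h1 : ContinuousOn (fun s => dist (α s) (β s)) (Set.Icc 0 m) :=
      continuous_dist.comp_continuousOn (hcα.prodMk hcβ)
    exact h1.preimage_isClosed_of_isClosed isClosed_Icc (isClosed_singleton (x := (0 : ℝ)))
  have hAc : IsCompact A := isCompact_Icc.of_isClosed_subset hAclosed fun s hs => hs.1
  have hA0 : A.Nonempty := ⟨0, ⟨le_rfl, hm⟩, by rw [hα.2.1, hβ.2.1, dist_self]⟩
  obtain ⟨t₀, ht₀, hmax⟩ := hAc.exists_isGreatest hA0
  have h0α : t₀ ∈ Set.Icc 0 (dist x y) := ⟨ht₀.1.1, ht₀.1.2.trans (min_le_left _ _)⟩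
  have h0β : t₀ ∈ Set.Icc 0 (dist x z) := ⟨ht₀.1.1, ht₀.1.2.trans (min_le_right _ _)⟩
  have hc : α t₀ = β t₀ := dist_eq_zero.1 ht₀.2
  have hβ' := hβ.drop h0β
  rw [← hc] at hβ'
  have hyz := hX.dist_eq_add_of_disjoint (hα.drop h0α) hβ' (by
    intro s hs t ht h
    have e1 := hα.dist_left (t := t₀ + s) ⟨by linarith [h0α.1, hs.1], by linarith [hs.2]⟩
    have e2 := hβ.dist_left (t := t₀ + t) ⟨by linarith [h0β.1, ht.1], by linarith [ht.2]⟩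
    rw [h] at e1
    have hst : s = t := by linarith
    subst hst
    have : t₀ + s ≤ t₀ := hmax ⟨⟨by linarith [h0β.1, ht.1],
      le_min (by linarith [hs.2]) (by linarith [ht.2])⟩, by rw [h, dist_self]⟩
    linarith [hs.1])
  have hg : gp x y z = t₀ := by unfold gp; rw [hyz]; ring
  rw [hg] at htg
  rcases ht₀.1.1.eq_or_lt with h | h
  · have : t = 0 := by linarith
    rw [this, hα.2.1, hβ.2.1]
  have hxc : x ≠ α t₀ := by
    intro hx
    have := hα.dist_left h0α
    rw [← hx, dist_self] at this
    linarith
  have hrβ := hβ.restrict h0β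
  rw [← hc] at hrβ
  -- Up to `t₀` uniqueness of arcs makes the images equal, and the parameter of a point is its
  -- distance from `x`.
  have himg := (hX.2 x (α t₀) hxc).1.unique ((hα.restrict h0α).isArc h) (hrβ.isArc h)
  have hmem : α t ∈ β '' Set.Icc 0 t₀ := himg ▸ ⟨t, ⟨ht, htg⟩, rfl⟩
  obtain ⟨t', ht', h'⟩ := hmem
  have e1 := hα.dist_left (t := t) ⟨ht, htg.trans h0α.2⟩
  have e2 := hβ.dist_left (t := t') ⟨ht'.1, ht'.2.trans h0β.2⟩
  rw [h'] at e2
  rw [← h', ← e2, e1]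

/-- Up to the smaller of the two Gromov products with `y`, the geodesics from `o` to `x` and `z`
both follow the one to `y`; their common point bounds `dist x z` from above. -/
theorem IsRTree.isTreeMetric (hX : IsRTree X) : IsTreeMetric X := by
  refine ⟨fun x y t h0 h1 => ?_, fun o x y z => ?_⟩
  · obtain ⟨α, hα⟩ := hX.exists_geodesicPath x y
    exact ⟨α t, hα.dist_left ⟨h0, h1⟩, hα.dist_right ⟨h0, h1⟩⟩
  · obtain ⟨α, hα⟩ := hX.exists_geodesicPath o x
    obtain ⟨β, hβ⟩ := hX.exists_geodesicPath o y
    obtain ⟨γ, hγ⟩ := hX.exists_geodesicPath o z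
    have key : ∀ t, 0 ≤ t → t ≤ gp o x y → t ≤ gp o y z → t ≤ gp o x z := by
      intro t h0 h1 h2
      have e : α t = γ t :=
        (hX.geodesicPath_agree hα hβ h0 h1).trans (hX.geodesicPath_agree hβ hγ h0 h2)
      have e1 := hα.dist_right ⟨h0, h1.trans (gp_le_left _ _ _)⟩
      have e2 := hγ.dist_right ⟨h0, h2.trans (gp_le_right _ _ _)⟩
      have e3 := dist_triangle_left x z (α t)
      rw [e] at e1 e3
      unfold gp
      linarith
    rcases le_total (gp o x y) (gp o y z) with h | h
    · exact Or.inl (key _ (gp_nonneg _ _ _) le_rfl h)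
    · exact Or.inr (key _ (gp_nonneg _ _ _) h le_rfl)

end ArcConstruction

/-! ### The metric axioms imply uniqueness of arcs. -/

section OfTreeMetric

variable {X : Type u} [MetricSpace X]

theorem eq_of_between (hX : IsTreeMetric X) {x y z w : X} (hz : dist x z + dist z y = dist x y)
    (hw : dist x w + dist w y = dist x y) (h : dist x z = dist x w) : z = w := by
  rw [← dist_eq_zero, dist_of_between hX hz hw, h, sub_self, abs_zero]

theorem IsTreeMetric.exists_geodesicPath (hX : IsTreeMetric X) (x y : X) :
    ∃ α, IsGeodesicPath x y (dist x y) α ∧ α '' Set.Icc 0 (dist x y) = seg x y := by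
  have h : ∀ t : ℝ, ∃ z, t ∈ Set.Icc 0 (dist x y) → dist x z = t ∧ dist z y = dist x y - t := by
    intro t
    by_cases ht : t ∈ Set.Icc 0 (dist x y)
    · obtain ⟨z, hz⟩ := hX.exists_between x y t ht.1 ht.2
      exact ⟨z, fun _ => hz⟩
    · exact ⟨x, fun h => absurd h ht⟩
  choose α hα using h
  have hbtw : ∀ t ∈ Set.Icc 0 (dist x y), dist x (α t) + dist (α t) y = dist x y := fun t ht => by
    rw [(hα t ht).1, (hα t ht).2]; ring
  refine ⟨α, ⟨dist_nonneg, ?_, ?_, fun s hs t ht => ?_⟩, ?_⟩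
  · exact (dist_eq_zero.1 (hα 0 ⟨le_rfl, dist_nonneg⟩).1).symm
  · exact dist_eq_zero.1 ((hα _ ⟨dist_nonneg, le_rfl⟩).2.trans (sub_self _))
  · rw [dist_of_between hX (hbtw s hs) (hbtw t ht), (hα s hs).1, (hα t ht).1]
  · ext z
    constructor
    · rintro ⟨t, ht, rfl⟩
      exact hbtw t ht
    · intro hz
      have hz' : dist x z + dist z y = dist x y := hz
      have ht : dist x z ∈ Set.Icc 0 (dist x y) :=
        ⟨dist_nonneg, by linarith [dist_nonneg (x := z) (y := y)]⟩
      exact ⟨dist x z, ht, eq_of_between hX (hbtw _ ht) hz (hα _ ht).1⟩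

/-- A preconnected set avoiding `c` lies on one side of `c`. -/
theorem gp_pos_of_isPreconnected (hX : IsTreeMetric X) {c : X} {s : Set X}
    (hs : IsPreconnected s) (hc : c ∉ s) {x y : X} (hx : x ∈ s) (hy : y ∈ s) : 0 < gp c x y := by
  have hcd : ∀ w ∈ s, 0 < dist c w := fun w hw => dist_pos.2 fun h => hc (h ▸ hw)
  -- `U` is the side of `c` containing `x`. A ball around `w` of radius `dist c w` stays on the side
  -- of `w`, so the remaining points of `s` are covered by an open set disjoint from `U`.
  let U : Set X := {w | 0 < gp c x w}
  let V : Set X := ⋃ w ∈ {w | w ∈ s ∧ gp c x w = 0}, Metric.ball w (dist c w)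
  have hcont : Continuous fun w => gp c x w := by unfold gp; fun_prop
  have hU : IsOpen U := isOpen_lt continuous_const hcont
  have hV : IsOpen V := isOpen_biUnion fun w _ => Metric.isOpen_ball
  have hVz : ∀ v ∈ V, gp c x v = 0 := by
    intro v hv
    simp only [V, Set.mem_iUnion, Set.mem_ofPred_eq] at hv
    obtain ⟨w, ⟨-, hw0⟩, hv⟩ := hv
    rw [Metric.mem_ball] at hv
    have h1 : 0 < gp c v w := by
      unfold gp
      have := dist_triangle_right c v w
      have := dist_nonneg (x := c) (y := v)
      linarith [dist_comm w v]
    by_contra hne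
    have h2 : 0 < gp c x v := lt_of_le_of_ne (gp_nonneg _ _ _) (Ne.symm hne)
    rcases hX.hyp c x v w with h | h <;> linarith
  have hdisj : s ∩ (U ∩ V) = ∅ := by
    ext v
    simp only [Set.mem_inter_iff, Set.mem_empty_iff_false, iff_false, not_and]
    intro _ hvU hvV
    exact hvU.ne' (hVz v hvV)
  have hcov : s ⊆ U ∪ V := by
    intro w hw
    rcases (gp_nonneg c x w).eq_or_lt with h | h
    · right
      simp only [V, Set.mem_iUnion, Set.mem_ofPred_eq]
      exact ⟨w, ⟨hw, h.symm⟩, by simpa using hcd w hw⟩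
    · exact Or.inl h
  rcases isPreconnected_iff_subset_of_disjoint.1 hs U V hU hV hcov hdisj with h | h
  · exact h hy
  · have h1 := hVz x (h hx)
    have h2 := hcd x hx
    unfold gp at h1
    rw [dist_self] at h1
    linarith

/-- The arc is connected, so it cannot avoid a point separating its ends and contains the segment.
Conversely, the inverse of the parametrization is continuous by compactness and maps the connected
segment to a connected subset of `[0,1]` containing both ends, hence onto it. -/
theorem IsTreeMetric.arc_eq_seg (hX : IsTreeMetric X) {x y : X} {s : Set X}
    (hs : IsArc x y s) : s = seg x y := by
  obtain ⟨γ, hγc, hγi, h0, h1, rfl⟩ := hs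
  have hconn : IsPreconnected (γ '' Set.Icc 0 1) := isPreconnected_Icc.image _ hγc
  have hxs : x ∈ γ '' Set.Icc 0 1 := ⟨0, by simp, h0⟩
  have hys : y ∈ γ '' Set.Icc 0 1 := ⟨1, by simp, h1⟩
  have hsub : seg x y ⊆ γ '' Set.Icc 0 1 := by
    intro z hz
    by_contra hzs
    have := gp_pos_of_isPreconnected hX hconn hzs hxs hys
    exact this.ne' (gp_eq_zero_iff.2 hz)
  refine Set.Subset.antisymm ?_ hsub
  obtain ⟨α, hα, himg⟩ := hX.exists_geodesicPath x y
  have hsegconn : IsPreconnected (seg x y) := by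
    rw [← himg]
    refine isPreconnected_Icc.image _ ?_
    have : LipschitzOnWith 1 α (Set.Icc 0 (dist x y)) := by
      apply LipschitzOnWith.of_dist_le_mul
      intro s hs t ht
      simpa [Real.dist_eq] using (hα.2.2.2 s hs t ht).le
    exact this.continuousOn
  have hinv : ContinuousOn (Function.invFunOn γ (Set.Icc 0 1)) (γ '' Set.Icc 0 1) := by
    have hcl : ∀ C : Set ℝ, IsClosed C → IsClosed (γ '' (C ∩ Set.Icc 0 1)) := fun C hC =>
      ((isCompact_Icc.inter_left hC).image_of_continuousOn
        (hγc.mono Set.inter_subset_right)).isClosed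
    rw [continuousOn_iff_isClosed]
    intro C hC
    refine ⟨γ '' (C ∩ Set.Icc 0 1), hcl C hC, ?_⟩
    ext z
    constructor
    · rintro ⟨hz, t, ht, rfl⟩
      have e := hγi.leftInvOn_invFunOn ht
      rw [Set.mem_preimage, e] at hz
      exact ⟨⟨t, ⟨hz, ht⟩, rfl⟩, t, ht, rfl⟩
    · rintro ⟨⟨t, ⟨hC', ht⟩, rfl⟩, hz⟩
      refine ⟨?_, hz⟩
      rw [Set.mem_preimage, hγi.leftInvOn_invFunOn ht]
      exact hC'
  have himg2 := hsegconn.image _ (hinv.mono hsub)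
  have hx' : (0 : ℝ) ∈ Function.invFunOn γ (Set.Icc 0 1) '' seg x y :=
    ⟨x, by simp [seg], by
      rw [← h0]; exact hγi.leftInvOn_invFunOn (by simp)⟩
  have hy' : (1 : ℝ) ∈ Function.invFunOn γ (Set.Icc 0 1) '' seg x y :=
    ⟨y, by simp [seg], by
      rw [← h1]; exact hγi.leftInvOn_invFunOn (by simp)⟩
  rintro _ ⟨t, ht, rfl⟩
  obtain ⟨z, hz, hzt⟩ := himg2.ordConnected.out hx' hy' ht
  have : γ t = z := by
    rw [← hzt]
    exact Function.invFunOn_eq (hsub hz)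
  rwa [this]

theorem IsTreeMetric.isRTree (hX : IsTreeMetric X) (hne : Nonempty X) : IsRTree X := by
  refine ⟨hne, fun x y hxy => ?_⟩
  obtain ⟨α, hα, himg⟩ := hX.exists_geodesicPath x y
  refine ⟨⟨seg x y, himg ▸ hα.isArc (dist_pos.2 hxy), fun s hs => hX.arc_eq_seg hs⟩,
    fun s hs => ?_⟩
  rw [hX.arc_eq_seg hs]
  exact ⟨α, hα.2.1, hα.2.2.1, hα.2.2.2, himg⟩

end OfTreeMetric

/-! ### Gated subsets -/

section Gated

variable {X : Type*} [MetricSpace X] {K : Set X}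

/-- `K` is gated if every point has a projection to `K` through which all geodesics to `K` pass. -/
def IsGated (K : Set X) : Prop :=
  ∀ z, ∃ q ∈ K, ∀ k ∈ K, dist z k = dist z q + dist q k

/-- The projection to a gated subset. -/
noncomputable def IsGated.gate (hK : IsGated K) (z : X) : X := (hK z).choose

theorem IsGated.gate_mem (hK : IsGated K) (z : X) : hK.gate z ∈ K := (hK z).choose_spec.1

theorem IsGated.dist_eq (hK : IsGated K) (z : X) {k : X} (hk : k ∈ K) :
    dist z k = dist z (hK.gate z) + dist (hK.gate z) k := (hK z).choose_spec.2 k hk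

theorem IsGated.gate_of_mem (hK : IsGated K) {z : X} (hz : z ∈ K) : hK.gate z = z := by
  have := hK.dist_eq z hz
  rw [dist_self] at this
  have h1 := dist_nonneg (x := z) (y := hK.gate z)
  have h2 := dist_nonneg (x := hK.gate z) (y := z)
  exact dist_eq_zero.1 (by linarith)

theorem IsGated.mem_of_between (hK : IsGated K) {x y z : X} (hx : x ∈ K) (hy : y ∈ K)
    (hz : dist x z + dist z y = dist x y) : z ∈ K := by
  have h1 := hK.dist_eq z hx
  have h2 := hK.dist_eq z hy
  have h3 := dist_triangle_left x y (hK.gate z)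
  have h4 : dist z (hK.gate z) = 0 := by
    rw [dist_comm x z] at hz
    linarith [dist_nonneg (x := z) (y := hK.gate z)]
  rw [dist_eq_zero.1 h4]
  exact hK.gate_mem z

theorem IsGated.dist_le (hK : IsGated K) (x y : X) :
    dist x y ≤ dist x (hK.gate x) + dist (hK.gate x) (hK.gate y) + dist y (hK.gate y) := by
  have := dist_triangle4 x (hK.gate x) (hK.gate y) y
  rwa [dist_comm (hK.gate y) y] at this

/-- At the gate of `x`, the point `y` lies in the direction of its own gate, and `x` does not; hence
the geodesic from `x` to `y` passes through the gate of `x`. -/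
theorem IsGated.dist_eq_of_ne (hX : IsTreeMetric X) (hK : IsGated K) {x y : X}
    (h : hK.gate x ≠ hK.gate y) :
    dist x y = dist x (hK.gate x) + dist (hK.gate x) (hK.gate y) + dist y (hK.gate y) := by
  have h1 := hK.dist_eq x (hK.gate_mem y)
  have h2 := hK.dist_eq y (hK.gate_mem x)
  have h3 : 0 < dist (hK.gate x) (hK.gate y) := dist_pos.2 h
  have h4 := dist_comm x (hK.gate x)
  have h5 := dist_comm y (hK.gate x)
  have h6 := dist_comm (hK.gate x) (hK.gate y)
  have h7 := dist_triangle x (hK.gate x) y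
  rcases hX.hyp (hK.gate x) x y (hK.gate y) with h | h <;> unfold gp at h <;> linarith

end Gated

/-! ### Normal forms in free products -/

section Letters

open Monoid

variable {J : Type*} {G : J → Type*} [∀ j, Group (G j)]

open Classical in
/-- The letters of the normal form of an element of a free product. -/
noncomputable def letters (w : CoprodI G) : List (Σ j, G j) := (CoprodI.Word.equiv w).toList

/-- The normal form of `w` does not start with a letter from `G i`. -/
def NotStart (i : J) (w : CoprodI G) : Prop := (letters w).head?.map Sigma.fst ≠ some i

theorem letters_one : letters (1 : CoprodI G) = [] := by
  classical
  have : CoprodI.Word.equiv (1 : CoprodI G) = CoprodI.Word.empty := by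
    rw [← Equiv.eq_symm_apply]; rfl
  unfold letters
  simp [this]

theorem letters_of_mul {i : J} {a : G i} {w : CoprodI G} (hw : NotStart i w) (ha : a ≠ 1) :
    letters (CoprodI.of a * w) = ⟨i, a⟩ :: letters w := by
  classical
  have hw' : (CoprodI.Word.equiv w).fstIdx ≠ some i := hw
  have : CoprodI.Word.equiv (CoprodI.of a * w) =
      CoprodI.Word.cons a (CoprodI.Word.equiv w) hw' ha := by
    rw [← Equiv.eq_symm_apply]
    change _ = CoprodI.Word.prod _
    rw [CoprodI.Word.prod_cons]
    congr 1
    exact (CoprodI.Word.equiv.symm_apply_apply w).symm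
  unfold letters
  rw [this, CoprodI.Word.cons_toList]

theorem notStart_one (i : J) : NotStart i (1 : CoprodI G) := by
  simp [NotStart, letters_one]

theorem NotStart.of_mul {i j : J} (hij : i ≠ j) {a : G i} {w : CoprodI G} (hw : NotStart i w)
    (ha : a ≠ 1) : NotStart j (CoprodI.of a * w) := by
  simpa [NotStart, letters_of_mul hw ha] using hij

theorem NotStart.not_of_mul {i : J} {a : G i} {w : CoprodI G} (hw : NotStart i w)
    (ha : a ≠ 1) : ¬ NotStart i (CoprodI.of a * w) := by
  simp [NotStart, letters_of_mul hw ha]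

theorem exists_eq_of_mul (i : J) (w : CoprodI G) :
    ∃ (a : G i) (w' : CoprodI G), NotStart i w' ∧ w = CoprodI.of a * w' := by
  classical
  let p := CoprodI.Word.equivPair i (CoprodI.Word.equiv w)
  refine ⟨p.head, CoprodI.Word.prod p.tail, ?_, ?_⟩
  · have : CoprodI.Word.equiv (CoprodI.Word.prod p.tail) = p.tail :=
      CoprodI.Word.equiv.apply_symm_apply p.tail
    unfold NotStart letters
    rw [this]
    exact p.fstIdx_ne
  · rw [← CoprodI.Word.prod_rcons]
    have : CoprodI.Word.rcons p = CoprodI.Word.equiv w :=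
      (CoprodI.Word.equivPair i).symm_apply_apply _
    rw [this]
    exact (CoprodI.Word.equiv.symm_apply_apply w).symm

theorem letters_induction {motive : CoprodI G → Prop} (one : motive 1)
    (of_mul : ∀ (i : J) (a : G i) (w : CoprodI G), a ≠ 1 → NotStart i w → motive w →
      motive (CoprodI.of a * w)) (w : CoprodI G) : motive w := by
  classical
  have key : ∀ w : CoprodI.Word G, motive (CoprodI.Word.prod w) := by
    intro w
    induction w using CoprodI.Word.consRecOn with
    | empty => exact one
    | cons i m w h1 h2 ih =>
      rw [CoprodI.Word.prod_cons]
      refine of_mul i m _ h2 ?_ ih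
      have : CoprodI.Word.equiv (CoprodI.Word.prod w) = w :=
        CoprodI.Word.equiv.apply_symm_apply w
      unfold NotStart letters
      rw [this]
      exact h1
  have := key (CoprodI.Word.equiv w)
  rwa [show CoprodI.Word.prod (CoprodI.Word.equiv w) = w from
    CoprodI.Word.equiv.symm_apply_apply w] at this

end Letters

/-! ### The quotient of a pseudometric -/

section Quotient

/-- An invariant pseudometric satisfying the axioms of a real tree gives an action on a real
tree. -/
theorem exists_tree_of_pseudometric {W : Type*} [Group W] {A : Type u} [MulAction W A]
    (d : A → A → ℝ) (d_self : ∀ a, d a a = 0) (d_comm : ∀ a b, d a b = d b a)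
    (d_smul : ∀ (w : W) a b, d (w • a) (w • b) = d a b)
    (d_between : ∀ a b t, 0 ≤ t → t ≤ d a b → ∃ c, d a c = t ∧ d c b = d a b - t)
    (d_hyp : ∀ o a b c, d o a + d o b - d a b ≤ d o a + d o c - d a c ∨
      d o b + d o c - d b c ≤ d o a + d o c - d a c) :
    ∃ (Y : Type u) (_ : MetricSpace Y) (_ : MulAction W Y) (_ : IsIsometricSMul W Y) (q : A → Y),
      IsTreeMetric Y ∧ (∀ a b, dist (q a) (q b) = d a b) ∧ ∀ (w : W) a, q (w • a) = w • q a := by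
  -- Gromov products at `b` with `b` itself vanish, so either alternative of `d_hyp` says that the
  -- product of `a` and `c` at `b` is nonnegative.
  have d_triangle : ∀ a b c, d a c ≤ d a b + d b c := by
    intro a b c
    have h1 := d_comm a b
    rcases d_hyp b a b c with h | h <;> linarith [d_self b, d_comm a b, d_comm b c]
  let : PseudoMetricSpace A :=
    { dist := d, dist_self := d_self, dist_comm := d_comm, dist_triangle := d_triangle }
  have hdist : ∀ a b : A, dist a b = d a b := fun _ _ => rfl
  have : IsIsometricSMul W A := ⟨fun w => Isometry.of_dist_eq fun a b => d_smul w a b⟩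
  refine ⟨SeparationQuotient A, inferInstance, inferInstance, ⟨fun w => ?_⟩,
    SeparationQuotient.mk, ⟨?_, ?_⟩, fun a b => SeparationQuotient.dist_mk a b, fun w a => rfl⟩
  · refine Isometry.of_dist_eq fun a b => ?_
    obtain ⟨a, rfl⟩ := SeparationQuotient.surjective_mk a
    obtain ⟨b, rfl⟩ := SeparationQuotient.surjective_mk b
    rw [← SeparationQuotient.mk_smul, ← SeparationQuotient.mk_smul, SeparationQuotient.dist_mk,
      SeparationQuotient.dist_mk, dist_smul]
  · intro a b t h0 h1
    obtain ⟨a, rfl⟩ := SeparationQuotient.surjective_mk a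
    obtain ⟨b, rfl⟩ := SeparationQuotient.surjective_mk b
    rw [SeparationQuotient.dist_mk] at h1
    obtain ⟨c, hc⟩ := d_between a b t h0 h1
    refine ⟨SeparationQuotient.mk c, ?_⟩
    simp only [SeparationQuotient.dist_mk]
    exact hc
  · intro o a b c
    obtain ⟨o, rfl⟩ := SeparationQuotient.surjective_mk o
    obtain ⟨a, rfl⟩ := SeparationQuotient.surjective_mk a
    obtain ⟨b, rfl⟩ := SeparationQuotient.surjective_mk b
    obtain ⟨c, rfl⟩ := SeparationQuotient.surjective_mk c
    simp only [gp, SeparationQuotient.dist_mk, hdist]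
    rcases d_hyp o a b c with h | h
    · left; linarith
    · right; linarith

end Quotient

/-! ### The tree of a free product acting relative to a gated subset -/

section Amalgam

open Monoid

variable {J : Type*} {G : J → Type*} [∀ j, Group (G j)] {T : Type u} [MetricSpace T]
  [MulAction (CoprodI G) T] {K : Set T}

/-- The projection to `K` of the point `x` of the translate of `K` indexed by a word. -/
noncomputable def retrList (hK : IsGated K) : List (Σ j, G j) → T → T
  | [], x => x
  | l :: ls, x => hK.gate ((CoprodI.of l.2 : CoprodI G) • retrList hK ls x)

/-- The distance to `K` of the point `x` of the translate of `K` indexed by a word. -/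
noncomputable def heightList (hK : IsGated K) : List (Σ j, G j) → T → ℝ
  | [], _ => 0
  | l :: ls, x => heightList hK ls x +
      dist ((CoprodI.of l.2 : CoprodI G) • retrList hK ls x)
        (hK.gate ((CoprodI.of l.2 : CoprodI G) • retrList hK ls x))

/-- The projection to `K` of the point `x` of the translate of `K` indexed by `w`. -/
noncomputable def retr (hK : IsGated K) (w : CoprodI G) (x : T) : T := retrList hK (letters w) x

/-- The distance to `K` of the point `x` of the translate of `K` indexed by `w`. -/
noncomputable def height (hK : IsGated K) (w : CoprodI G) (x : T) : ℝ :=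
  heightList hK (letters w) x

theorem retr_one (hK : IsGated K) (x : T) : retr hK (1 : CoprodI G) x = x := by
  simp [retr, letters_one, retrList]

theorem height_one (hK : IsGated K) (x : T) : height hK (1 : CoprodI G) x = 0 := by
  simp [height, letters_one, heightList]

theorem retr_mem (hK : IsGated K) (w : CoprodI G) {x : T} (hx : x ∈ K) : retr hK w x ∈ K := by
  unfold retr
  cases letters w with
  | nil => exact hx
  | cons l ls => exact hK.gate_mem _

/-- The case `a = 1` is included because the decomposition of `exists_eq_of_mul` may have a trivial
leading letter. -/
theorem retr_of_mul (hK : IsGated K) {i : J} (a : G i) {w : CoprodI G} (hw : NotStart i w)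
    {x : T} (hx : x ∈ K) :
    retr hK (CoprodI.of a * w) x = hK.gate ((CoprodI.of a : CoprodI G) • retr hK w x) := by
  by_cases ha : a = 1
  · subst ha
    rw [map_one, one_mul, one_smul, hK.gate_of_mem (retr_mem hK w hx)]
  · simp [retr, letters_of_mul hw ha, retrList]

theorem height_of_mul (hK : IsGated K) {i : J} (a : G i) {w : CoprodI G} (hw : NotStart i w)
    {x : T} (hx : x ∈ K) :
    height hK (CoprodI.of a * w) x = height hK w x +
      dist ((CoprodI.of a : CoprodI G) • retr hK w x)
        (hK.gate ((CoprodI.of a : CoprodI G) • retr hK w x)) := by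
  by_cases ha : a = 1
  · subst ha
    rw [map_one, one_mul, one_smul, hK.gate_of_mem (retr_mem hK w hx), dist_self, add_zero]
  · simp [height, retr, letters_of_mul hw ha, heightList]

theorem heightList_nonneg (hK : IsGated K) (l : List (Σ j, G j)) (x : T) :
    0 ≤ heightList hK l x := by
  induction l with
  | nil => exact le_rfl
  | cons l ls ih => exact add_nonneg ih dist_nonneg

/-- The distance from a point of `K`, in terms of the last translate passed. -/
theorem height_add_dist (hK : IsGated K) {i : J} (a : G i) {w : CoprodI G} (hw : NotStart i w)
    {x o : T} (hx : x ∈ K) (ho : o ∈ K) :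
    height hK (CoprodI.of a * w) x + dist o (retr hK (CoprodI.of a * w) x) =
      height hK w x + dist o ((CoprodI.of a : CoprodI G) • retr hK w x) := by
  rw [height_of_mul hK a hw hx, retr_of_mul hK a hw hx, dist_comm o, dist_comm o,
    hK.dist_eq ((CoprodI.of a : CoprodI G) • retr hK w x) ho]
  ring

/-- The distance between the point `x` of the translate of `K` indexed by `u` and the point `y`
of the translate of `K` indexed by `v`. -/
noncomputable def amDist (hK : IsGated K) (u : CoprodI G) (x : T) (v : CoprodI G) (y : T) : ℝ :=
  height hK (u⁻¹ * v) y + dist x (retr hK (u⁻¹ * v) y)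

theorem amDist_mul (hK : IsGated K) (g u : CoprodI G) (x : T) (v : CoprodI G) (y : T) :
    amDist hK (g * u) x (g * v) y = amDist hK u x v y := by
  unfold amDist
  rw [show (g * u)⁻¹ * (g * v) = u⁻¹ * v by group]

theorem amDist_one (hK : IsGated K) (x : T) (v : CoprodI G) (y : T) :
    amDist hK 1 x v y = height hK v y + dist x (retr hK v y) := by
  simp [amDist]

theorem amDist_self (hK : IsGated K) (u : CoprodI G) (x : T) : amDist hK u x u x = 0 := by
  rw [amDist, inv_mul_cancel, height_one, retr_one, dist_self, add_zero]

/-- If the amalgam distance of two points of `K` vanishes, they are related by a chain of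
translations by letters within `K`. -/
theorem chain_of_amDist_eq_zero (hK : IsGated K) {w : CoprodI G} {D : Set T}
    (hD : ∀ (i : J) (a : G i), ∀ x ∈ D, (CoprodI.of a : CoprodI G) • x ∈ K →
      (CoprodI.of a : CoprodI G) • x ∈ D) {x y : T} (hx : x ∈ D)
    (h : amDist hK 1 y w x = 0) : y ∈ D := by
  -- Height zero means that no projection moves anything: after every letter the point already lies
  -- in `K`, so it stays in `D`.
  have key : ∀ l : List (Σ j, G j), heightList hK l x = 0 → retrList hK l x ∈ D := by
    intro l
    induction l with
    | nil => exact fun _ => hx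
    | cons l ls ih =>
      intro h
      simp only [heightList] at h
      have h1 := heightList_nonneg hK ls x
      have h2 := dist_nonneg (x := (CoprodI.of l.2 : CoprodI G) • retrList hK ls x)
        (y := hK.gate ((CoprodI.of l.2 : CoprodI G) • retrList hK ls x))
      have h3 := ih (by linarith)
      have h4 : dist ((CoprodI.of l.2 : CoprodI G) • retrList hK ls x)
        (hK.gate ((CoprodI.of l.2 : CoprodI G) • retrList hK ls x)) = 0 := by linarith
      simp only [retrList]
      have h5 := hK.gate_mem ((CoprodI.of l.2 : CoprodI G) • retrList hK ls x)
      rw [← dist_eq_zero.1 h4] at h5 ⊢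
      exact hD _ _ _ h3 h5
  rw [amDist_one] at h
  have h1 := heightList_nonneg hK (letters w) x
  have h2 := dist_nonneg (x := y) (y := retr hK w x)
  have h3 : dist y (retr hK w x) = 0 := by unfold height at h; linarith
  rw [dist_eq_zero.1 h3]
  exact key _ (by unfold height at h; linarith)

variable [IsIsometricSMul (CoprodI G) T]

/-- If `u` and `v` do not begin in the same factor, no cancellation occurs in `u⁻¹ * v`. The
induction transfers one letter at a time from `u` to `v`. -/
theorem amDist_of_disjoint (hK : IsGated K) {u v : CoprodI G}
    (h : ∀ i, NotStart i u ∨ NotStart i v) {x y : T} (hx : x ∈ K) (hy : y ∈ K) :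
    amDist hK u x v y = height hK u x + height hK v y + dist (retr hK u x) (retr hK v y) := by
  induction u using letters_induction generalizing v with
  | one => rw [amDist_one, height_one, retr_one, zero_add]
  | of_mul i a u ha hu ih =>
    have hv : NotStart i v := (h i).resolve_left (hu.not_of_mul ha)
    rw [← amDist_mul hK (CoprodI.of a)⁻¹, inv_mul_cancel_left, ← map_inv, ih]
    · have h1 := height_add_dist hK a⁻¹ hv hy (retr_mem hK u hx)
      rw [height_of_mul hK a hu hx, retr_of_mul hK a hu hx, add_assoc, h1]
      have h2 := hK.dist_eq ((CoprodI.of a : CoprodI G) • retr hK u x) (retr_mem hK v hy)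
      have h3 : dist (retr hK u x) ((CoprodI.of a⁻¹ : CoprodI G) • retr hK v y) =
          dist ((CoprodI.of a : CoprodI G) • retr hK u x) (retr hK v y) := by
        rw [← dist_smul (CoprodI.of a : CoprodI G), smul_smul, ← map_mul, mul_inv_cancel,
          map_one, one_smul]
      rw [h3, h2]
      ring
    · intro j
      by_cases hij : i = j
      · subst hij; exact Or.inl hu
      · exact Or.inr (hv.of_mul hij (inv_ne_one.2 ha))

/-- Here `a⁻¹ * b` is a single nontrivial letter, so the path runs through the translates of `K` by
the factor, where distances are those of `T`; it need not pass through `K`. -/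
theorem amDist_of_ne (hK : IsGated K) {i : J} {a b : G i} (hab : a ≠ b) {u v : CoprodI G}
    (hu : NotStart i u) (hv : NotStart i v) {x y : T} (hx : x ∈ K) (hy : y ∈ K) :
    amDist hK (CoprodI.of a * u) x (CoprodI.of b * v) y = height hK u x + height hK v y +
      dist ((CoprodI.of a : CoprodI G) • retr hK u x)
        ((CoprodI.of b : CoprodI G) • retr hK v y) := by
  have hc : a⁻¹ * b ≠ 1 := fun h => hab (inv_mul_eq_one.1 h)
  rw [← amDist_mul hK (CoprodI.of a)⁻¹, inv_mul_cancel_left, ← mul_assoc, ← map_inv, ← map_mul,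
    amDist_of_disjoint hK _ hx hy, add_assoc, height_add_dist hK _ hv hy (retr_mem hK u hx),
    ← dist_smul (CoprodI.of a : CoprodI G) (retr hK u x), smul_smul, ← map_mul,
    mul_inv_cancel_left]
  · ring
  · intro j
    by_cases hij : i = j
    · subst hij; exact Or.inl hu
    · exact Or.inr (hv.of_mul hij hc)

theorem amDist_comm (hK : IsGated K) (u : CoprodI G) {x : T} (hx : x ∈ K) (v : CoprodI G)
    {y : T} (hy : y ∈ K) : amDist hK u x v y = amDist hK v y u x := by
  rw [← amDist_mul hK v⁻¹ v, inv_mul_cancel, ← amDist_mul hK v⁻¹ u, inv_mul_cancel, amDist_one,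
    amDist_of_disjoint hK (fun i => Or.inr (notStart_one i)) hx hy, height_one, retr_one,
    dist_comm y]
  ring

/-- Distances are bounded by the path through the projections to `K`, and this path is geodesic
if the projections differ. -/
theorem amDist_retr (hT : IsTreeMetric T) (hK : IsGated K) (u v : CoprodI G) {x y : T}
    (hx : x ∈ K) (hy : y ∈ K) :
    amDist hK u x v y ≤ height hK u x + height hK v y + dist (retr hK u x) (retr hK v y) ∧
      (retr hK u x ≠ retr hK v y → amDist hK u x v y =
        height hK u x + height hK v y + dist (retr hK u x) (retr hK v y)) := by
  induction u using letters_induction generalizing v with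
  | one =>
    have := amDist_of_disjoint hK (u := 1) (v := v) (fun i => Or.inl (notStart_one i)) hx hy
    exact ⟨this.le, fun _ => this⟩
  | of_mul i a u ha hu ih =>
    obtain ⟨b, v, hv, rfl⟩ := exists_eq_of_mul i v
    rw [height_of_mul hK a hu hx, height_of_mul hK b hv hy, retr_of_mul hK a hu hx,
      retr_of_mul hK b hv hy]
    set s := (CoprodI.of a : CoprodI G) • retr hK u x
    set t := (CoprodI.of b : CoprodI G) • retr hK v y with ht
    have h1 := hK.dist_le s t
    -- Equal leading letters cancel, and the induction hypothesis applies to the tails; distinct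
    -- ones give an exact formula in `T`.
    by_cases hab : a = b
    · subst hab
      rw [amDist_mul]
      have h2 : dist (retr hK u x) (retr hK v y) = dist s t := by rw [dist_smul]
      have h3 := (ih v).1
      rw [h2] at h3
      refine ⟨by linarith, fun hne => ?_⟩
      have h4 := hK.dist_eq_of_ne hT hne
      rw [(ih v).2 fun h => hne (by rw [ht, ← h]), h2]
      linarith
    · rw [amDist_of_ne hK hab hu hv hx hy]
      refine ⟨by linarith, fun hne => ?_⟩
      have h4 := hK.dist_eq_of_ne hT hne
      linarith

/-- The analogue of `amDist_retr` for the translates of `K` by a factor. -/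
theorem amDist_block (hT : IsTreeMetric T) (hK : IsGated K) {i : J} (a b : G i)
    {u v : CoprodI G} (hu : NotStart i u) (hv : NotStart i v) {x y : T}
    (hx : x ∈ K) (hy : y ∈ K) :
    amDist hK (CoprodI.of a * u) x (CoprodI.of b * v) y ≤ height hK u x + height hK v y +
        dist ((CoprodI.of a : CoprodI G) • retr hK u x)
          ((CoprodI.of b : CoprodI G) • retr hK v y) ∧
      ((CoprodI.of a : CoprodI G) • retr hK u x ≠ (CoprodI.of b : CoprodI G) • retr hK v y →
        amDist hK (CoprodI.of a * u) x (CoprodI.of b * v) y = height hK u x + height hK v y +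
          dist ((CoprodI.of a : CoprodI G) • retr hK u x)
            ((CoprodI.of b : CoprodI G) • retr hK v y)) := by
  by_cases hab : a = b
  · subst hab
    rw [amDist_mul, dist_smul]
    have := amDist_retr hT hK u v hx hy
    exact ⟨this.1, fun h => this.2 fun h' => h (by rw [h'])⟩
  · have := amDist_of_ne hK hab hu hv hx hy
    exact ⟨this.le, fun _ => this⟩

/-- The ultrametric inequality for points hanging off a tree at prescribed points. -/
theorem hyp_of_projections (hT : IsTreeMetric T) {o p q r : T} {hP hQ hR dP dQ dR dPQ dQR dPR : ℝ}
    (eP : dP = hP + dist o p) (eQ : dQ = hQ + dist o q) (eR : dR = hR + dist o r)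
    (lPQ : dPQ ≤ hP + hQ + dist p q) (nPQ : p ≠ q → dPQ = hP + hQ + dist p q)
    (lQR : dQR ≤ hQ + hR + dist q r) (nQR : q ≠ r → dQR = hQ + hR + dist q r)
    (lPR : dPR ≤ hP + hR + dist p r)
    (h : dPQ = hP + hQ + dist p q ∨ dQR = hQ + hR + dist q r) :
    dP + dQ - dPQ ≤ dP + dR - dPR ∨ dQ + dR - dQR ≤ dP + dR - dPR := by
  have key := hT.hyp o p q r
  simp only [gp] at key
  by_cases h1 : dPQ = hP + hQ + dist p q
  · by_cases h2 : dQR = hQ + hR + dist q r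
    · rcases key with k | k
      · left; linarith
      · right; linarith
    -- When the projections of the second and third points coincide, both have the same bound for
    -- their product with the first point, and for the second point it is attained.
    · have : q = r := by by_contra hne; exact h2 (nQR hne)
      subst this
      left; linarith [dist_self q]
  · have h2 := h.resolve_left h1
    have : p = q := by by_contra hne; exact h1 (nPQ hne)
    subst this
    right; linarith [dist_self p]

/-- The three points hang off the union of the translates of `K` by one factor, embedded in `T`. The
condition on the letters makes one of the two distances to the middle point exact. -/
theorem amDist_hyp_of_ne (hT : IsTreeMetric T) (hK : IsGated K) {u v w : CoprodI G}
    {o x y z : T} (ho : o ∈ K) (hx : x ∈ K) (hy : y ∈ K) (hz : z ∈ K) {i : J} {a b c : G i}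
    (hu : NotStart i u) (hv : NotStart i v) (hw : NotStart i w) (habc : a ≠ b ∨ b ≠ c) :
    amDist hK 1 o (CoprodI.of a * u) x + amDist hK 1 o (CoprodI.of b * v) y -
        amDist hK (CoprodI.of a * u) x (CoprodI.of b * v) y ≤
      amDist hK 1 o (CoprodI.of a * u) x + amDist hK 1 o (CoprodI.of c * w) z -
        amDist hK (CoprodI.of a * u) x (CoprodI.of c * w) z ∨
    amDist hK 1 o (CoprodI.of b * v) y + amDist hK 1 o (CoprodI.of c * w) z -
        amDist hK (CoprodI.of b * v) y (CoprodI.of c * w) z ≤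
      amDist hK 1 o (CoprodI.of a * u) x + amDist hK 1 o (CoprodI.of c * w) z -
        amDist hK (CoprodI.of a * u) x (CoprodI.of c * w) z := by
  have hab := amDist_block hT hK a b hu hv hx hy
  have hbc := amDist_block hT hK b c hv hw hy hz
  have hac := amDist_block hT hK a c hu hw hx hz
  refine hyp_of_projections hT (o := o) ?_ ?_ ?_ hab.1 hab.2 hbc.1 hbc.2 hac.1 ?_
  · rw [amDist_one, height_add_dist hK a hu hx ho]
  · rw [amDist_one, height_add_dist hK b hv hy ho]
  · rw [amDist_one, height_add_dist hK c hw hz ho]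
  · rcases habc with h | h
    · exact Or.inl (amDist_of_ne hK h hu hv hx hy)
    · exact Or.inr (amDist_of_ne hK h hv hw hy hz)

theorem amDist_hyp_of_disjoint (hT : IsTreeMetric T) (hK : IsGated K) {u v w : CoprodI G}
    {o x y z : T} (hx : x ∈ K) (hy : y ∈ K) (hz : z ∈ K)
    (h : (∀ i, NotStart i u ∨ NotStart i v) ∨ (∀ i, NotStart i v ∨ NotStart i w)) :
    amDist hK 1 o u x + amDist hK 1 o v y - amDist hK u x v y ≤
      amDist hK 1 o u x + amDist hK 1 o w z - amDist hK u x w z ∨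
    amDist hK 1 o v y + amDist hK 1 o w z - amDist hK v y w z ≤
      amDist hK 1 o u x + amDist hK 1 o w z - amDist hK u x w z := by
  have huv := amDist_retr hT hK u v hx hy
  have hvw := amDist_retr hT hK v w hy hz
  have huw := amDist_retr hT hK u w hx hz
  refine hyp_of_projections hT (o := o) (amDist_one hK o u x) (amDist_one hK o v y)
    (amDist_one hK o w z) huv.1 huv.2 hvw.1 hvw.2 huw.1 ?_
  rcases h with h | h
  · exact Or.inl (amDist_of_disjoint hK h hx hy)
  · exact Or.inr (amDist_of_disjoint hK h hy hz)

/-- The first summand does not depend on `u` or `x`. Stripping a common leading letter therefore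
changes all Gromov products by the same constant and only moves the base point within `K`. -/
theorem amDist_one_of_mul (hK : IsGated K) {i : J} (a : G i) {u : CoprodI G}
    (hu : NotStart i u) {o x : T} (ho : o ∈ K) (hx : x ∈ K) :
    amDist hK 1 o (CoprodI.of a * u) x =
      dist ((CoprodI.of a : CoprodI G)⁻¹ • o) (hK.gate ((CoprodI.of a : CoprodI G)⁻¹ • o)) +
        amDist hK 1 (hK.gate ((CoprodI.of a : CoprodI G)⁻¹ • o)) u x := by
  rw [amDist_one, height_add_dist hK a hu hx ho, amDist_one,
    ← dist_smul (CoprodI.of a : CoprodI G)⁻¹ o, inv_smul_smul,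
    hK.dist_eq ((CoprodI.of a : CoprodI G)⁻¹ • o) (retr_mem hK u hx)]
  ring

/-- Induction on the middle word: a leading letter common to all three words is stripped with
`amDist_one_of_mul`, and otherwise the ultrametric inequality is inherited from `T` by projection.
-/
theorem amDist_hyp_one (hT : IsTreeMetric T) (hK : IsGated K) (u v w : CoprodI G)
    {o x y z : T} (ho : o ∈ K) (hx : x ∈ K) (hy : y ∈ K) (hz : z ∈ K) :
    amDist hK 1 o u x + amDist hK 1 o v y - amDist hK u x v y ≤
      amDist hK 1 o u x + amDist hK 1 o w z - amDist hK u x w z ∨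
    amDist hK 1 o v y + amDist hK 1 o w z - amDist hK v y w z ≤
      amDist hK 1 o u x + amDist hK 1 o w z - amDist hK u x w z := by
  induction v using letters_induction generalizing u w o with
  | one => exact amDist_hyp_of_disjoint hT hK hx hy hz (Or.inl fun i => Or.inr (notStart_one i))
  | of_mul i b v hb hv ih =>
    obtain ⟨a, u, hu, rfl⟩ := exists_eq_of_mul i u
    obtain ⟨c, w, hw, rfl⟩ := exists_eq_of_mul i w
    by_cases hab : a = b
    · by_cases hbc : b = c
      · subst hab hbc
        simp only [amDist_one_of_mul hK a hu ho hx, amDist_one_of_mul hK a hv ho hy,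
          amDist_one_of_mul hK a hw ho hz, amDist_mul]
        rcases ih u w (hK.gate_mem ((CoprodI.of a : CoprodI G)⁻¹ • o)) with h | h
        · left; linarith
        · right; linarith
      · exact amDist_hyp_of_ne hT hK ho hx hy hz hu hv hw (Or.inr hbc)
    · exact amDist_hyp_of_ne hT hK ho hx hy hz hu hv hw (Or.inl hab)

theorem amDist_hyp (hT : IsTreeMetric T) (hK : IsGated K) (g u v w : CoprodI G)
    {o x y z : T} (ho : o ∈ K) (hx : x ∈ K) (hy : y ∈ K) (hz : z ∈ K) :
    amDist hK g o u x + amDist hK g o v y - amDist hK u x v y ≤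
      amDist hK g o u x + amDist hK g o w z - amDist hK u x w z ∨
    amDist hK g o v y + amDist hK g o w z - amDist hK v y w z ≤
      amDist hK g o u x + amDist hK g o w z - amDist hK u x w z := by
  have := amDist_hyp_one hT hK (g⁻¹ * u) (g⁻¹ * v) (g⁻¹ * w) ho hx hy hz
  rw [← inv_mul_cancel g] at this
  simpa only [amDist_mul] using this

theorem amDist_triangle (hT : IsTreeMetric T) (hK : IsGated K) (u v w : CoprodI G)
    {x y z : T} (hx : x ∈ K) (hy : y ∈ K) (hz : z ∈ K) :
    amDist hK u x w z ≤ amDist hK u x v y + amDist hK v y w z := by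
  have h1 := amDist_comm hK u hx v hy
  have h2 := amDist_self hK v y
  rcases amDist_hyp hT hK v u v w hy hx hy hz with h | h <;> linarith

theorem amDist_between_one (hT : IsTreeMetric T) (hK : IsGated K)
    (hconv : ∀ (i : J) (a b : G i), ∀ x ∈ K, ∀ y ∈ K, ∀ z,
      dist ((CoprodI.of a : CoprodI G) • x) z + dist z ((CoprodI.of b : CoprodI G) • y) =
        dist ((CoprodI.of a : CoprodI G) • x) ((CoprodI.of b : CoprodI G) • y) →
      ∃ (c : G i), (CoprodI.of c : CoprodI G) • z ∈ K)
    (v : CoprodI G) {x y : T} (hx : x ∈ K) (hy : y ∈ K) {t : ℝ} (h0 : 0 ≤ t)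
    (h1 : t ≤ amDist hK 1 x v y) :
    ∃ (w : CoprodI G) (z : T), z ∈ K ∧ amDist hK 1 x w z = t ∧
      amDist hK w z v y = amDist hK 1 x v y - t := by
  induction v using letters_induction generalizing x t with
  | one =>
    simp only [amDist_one, height_one, retr_one, zero_add] at h1 ⊢
    obtain ⟨z, hz1, hz2⟩ := hT.exists_between x y t h0 h1
    refine ⟨1, z, hK.mem_of_between hx hy (by rw [hz1, hz2]; ring), ?_, ?_⟩
    · rw [height_one, retr_one, zero_add, hz1]
    · rw [amDist_one, height_one, retr_one, zero_add, hz2]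
  | of_mul i a v ha hv ih =>
    have e := height_add_dist hK a hv hy hx
    have hk := retr_mem hK v hy
    set k := retr hK v y
    have e2 : amDist hK 1 x (CoprodI.of a * v) y = height hK v y +
        dist x ((CoprodI.of a : CoprodI G) • k) := by rw [amDist_one, e]
    have e3 : amDist hK 1 x (CoprodI.of a) k = dist x ((CoprodI.of a : CoprodI G) • k) := by
      have h2 := height_add_dist hK a (notStart_one i) hk hx
      rwa [mul_one, height_one, retr_one, zero_add, ← amDist_one] at h2
    have e4 : amDist hK (CoprodI.of a) k (CoprodI.of a * v) y = height hK v y := by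
      have h2 := amDist_mul hK (CoprodI.of a) 1 k v y
      rw [mul_one] at h2
      rw [h2, amDist_one, dist_self, add_zero]
    -- The path goes through the point `k` of the translate indexed by `a`. Before it, the path lies
    -- in `T`, and `hconv` finds its points in translates of `K`; after it, the path is a translate
    -- of one to the shorter word `v`.
    rcases le_total t (dist x ((CoprodI.of a : CoprodI G) • k)) with ht | ht
    · obtain ⟨s, hs1, hs2⟩ := hT.exists_between x ((CoprodI.of a : CoprodI G) • k) t h0 ht
      obtain ⟨c, hc⟩ := hconv i 1 a x hx k hk s (by
        rw [map_one, one_smul, hs1, hs2]; ring)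
      have e5 : amDist hK 1 x (CoprodI.of c⁻¹) ((CoprodI.of c : CoprodI G) • s) = t := by
        have h2 := height_add_dist hK c⁻¹ (notStart_one i) hc hx
        rw [mul_one, height_one, retr_one, zero_add, ← amDist_one, map_inv, inv_smul_smul] at h2
        rw [map_inv, h2, hs1]
      refine ⟨CoprodI.of c⁻¹, (CoprodI.of c : CoprodI G) • s, hc, e5, ?_⟩
      have h3 := (amDist_block hT hK c⁻¹ a (notStart_one i) hv hc hy).1
      rw [mul_one, height_one, retr_one, map_inv, inv_smul_smul, ← map_inv] at h3
      have h4 := amDist_triangle hT hK 1 (CoprodI.of c⁻¹) (CoprodI.of a * v) hx hc hy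
      linarith
    · obtain ⟨w, z, hz, hz1, hz2⟩ := ih hk
        (t := t - dist x ((CoprodI.of a : CoprodI G) • k)) (by linarith)
        (by rw [amDist_one, dist_self]; linarith)
      have h2 : amDist hK 1 k v y = height hK v y := by rw [amDist_one, dist_self, add_zero]
      have e5 : amDist hK (CoprodI.of a) k (CoprodI.of a * w) z = amDist hK 1 k w z := by
        have h2 := amDist_mul hK (CoprodI.of a) 1 k w z
        rwa [mul_one] at h2
      have e6 := amDist_mul hK (CoprodI.of a) w z v y
      have t1 := amDist_triangle hT hK 1 (CoprodI.of a) (CoprodI.of a * w) hx hk hz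
      have t2 := amDist_triangle hT hK 1 (CoprodI.of a * w) (CoprodI.of a * v) hx hz hy
      exact ⟨CoprodI.of a * w, z, hz, by linarith, by linarith⟩

end Amalgam

/-! ### Passage from the amalgam pseudometric to a tree. -/

section AmalgamTree

open Monoid

variable {J : Type} {G : J → Type} [∀ j, Group (G j)] {T : Type u} [MetricSpace T]
  [MulAction (CoprodI G) T] [IsIsometricSMul (CoprodI G) T] {K : Set T}

/-- A free product acting on a tree acts on another tree containing `K` in which the letters act
on `K` as before, and in which points of `K` are identified only by chains of letters. -/
theorem exists_amalgam (hT : IsTreeMetric T) (hK : IsGated K)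
    (hconv : ∀ (i : J) (a b : G i), ∀ x ∈ K, ∀ y ∈ K, ∀ z,
      dist ((CoprodI.of a : CoprodI G) • x) z + dist z ((CoprodI.of b : CoprodI G) • y) =
        dist ((CoprodI.of a : CoprodI G) • x) ((CoprodI.of b : CoprodI G) • y) →
      ∃ (c : G i), (CoprodI.of c : CoprodI G) • z ∈ K) :
    ∃ (Y : Type u) (_ : MetricSpace Y) (_ : MulAction (CoprodI G) Y)
      (_ : IsIsometricSMul (CoprodI G) Y) (ι : K → Y),
      IsTreeMetric Y ∧ Isometry ι ∧
      (∀ (i : J) (a : G i) (x y : K), (CoprodI.of a : CoprodI G) • (x : T) = y →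
        (CoprodI.of a : CoprodI G) • ι x = ι y) ∧
      ∀ D : Set T, (∀ (i : J) (a : G i), ∀ x ∈ D, (CoprodI.of a : CoprodI G) • x ∈ K →
          (CoprodI.of a : CoprodI G) • x ∈ D) →
        ∀ (w : CoprodI G) (x y : K), (x : T) ∈ D → w • ι x = ι y → (y : T) ∈ D := by
  -- A pair `(w, x)` stands for the point `x` of the copy of `K` indexed by `w`.
  let A := CoprodI G × K
  let : MulAction (CoprodI G) A :=
    { smul := fun g P => (g * P.1, P.2)
      one_smul := fun P => by
        change (1 * P.1, P.2) = P
        rw [one_mul]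
      mul_smul := fun g h P => by
        change (g * h * P.1, P.2) = (g * (h * P.1), P.2)
        rw [mul_assoc] }
  have hsm : ∀ (g : CoprodI G) (P : A), g • P = (g * P.1, P.2) := fun _ _ => rfl
  obtain ⟨Y, m1, m2, m3, q, hY, hq, hqs⟩ := exists_tree_of_pseudometric (W := CoprodI G) (A := A)
    (fun P Q => amDist hK P.1 P.2 Q.1 Q.2) (fun P => amDist_self hK _ _)
    (fun P Q => amDist_comm hK _ P.2.2 _ Q.2.2) (fun w P Q => amDist_mul hK _ _ _ _ _)
    (fun P Q t h0 h1 => by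
      have h2 := amDist_mul hK P.1⁻¹ P.1 P.2 Q.1 Q.2
      rw [inv_mul_cancel] at h2
      obtain ⟨w, z, hz, hz1, hz2⟩ := amDist_between_one hT hK hconv (P.1⁻¹ * Q.1) P.2.2 Q.2.2 h0
        (h2.symm ▸ h1)
      refine ⟨(P.1 * w, ⟨z, hz⟩), ?_, ?_⟩
      · have h3 := amDist_mul hK P.1 1 P.2 w z
        rw [mul_one] at h3
        exact h3.trans hz1
      · have h3 := amDist_mul hK P.1 w z (P.1⁻¹ * Q.1) Q.2
        rw [mul_inv_cancel_left] at h3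
        exact h3.trans (hz2.trans (by rw [h2])))
    (fun O P Q R => amDist_hyp hT hK _ _ _ _ O.2.2 P.2.2 Q.2.2 R.2.2)
  refine ⟨Y, m1, m2, m3, fun x => q (1, x), hY, ?_, ?_, ?_⟩
  · refine Isometry.of_dist_eq fun x y => ?_
    rw [hq, amDist_one, height_one, retr_one, zero_add]
    rfl
  · intro i a x y hxy
    rw [← hqs, ← dist_eq_zero, hq]
    simp only [hsm, mul_one]
    rw [amDist_comm hK _ x.2 _ y.2, amDist_one]
    have h2 := height_add_dist hK a (notStart_one i) x.2 y.2
    rw [mul_one, height_one, retr_one, zero_add, hxy, dist_self] at h2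
    exact h2
  · intro D hD w x y hx h
    rw [← hqs, ← dist_eq_zero, hq] at h
    simp only [hsm, mul_one] at h
    rw [amDist_comm hK _ x.2 _ y.2] at h
    exact chain_of_amDist_eq_zero hK hD hx h

end AmalgamTree

/-! ### Finite subtrees -/

section FiniteSubtree

variable {X : Type u} [MetricSpace X]

/-- Triangles are tripods: a point on one side lies on one of the other two. -/
theorem between_or_of_between (hX : IsTreeMetric X) {x y z : X} (p : X)
    (hz : dist x z + dist z y = dist x y) :
    dist p z + dist z x = dist p x ∨ dist p z + dist z y = dist p y := by
  have h0 := gp_eq_zero_iff.2 hz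
  rcases hX.hyp z x p y with h | h
  · left
    have := gp_eq_zero_iff.1 (le_antisymm (h0 ▸ h) (gp_nonneg _ _ _))
    rw [dist_comm p z, dist_comm z x, dist_comm p x, add_comm]; exact this
  · right
    exact gp_eq_zero_iff.1 (le_antisymm (h0 ▸ h) (gp_nonneg _ _ _))

theorem between_trans {p z x f : X} (h₁ : dist p z + dist z x = dist p x)
    (h₂ : dist p x + dist x f = dist p f) : dist p z + dist z f = dist p f := by
  have := dist_triangle z x f
  have := dist_triangle p z f
  linarith

/-- The convex hull of a finite set is a union of segments issuing from any of its points. -/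
theorem mem_hull_iff (hX : IsTreeMetric X) {P K : Set X} (hne : P.Nonempty)
    (hK : K = ⋂₀ {S : Set X | IsSubtree S ∧ P ⊆ S}) {p : X} (hp : p ∈ K) (x : X) :
    x ∈ K ↔ ∃ f ∈ P, dist p x + dist x f = dist p f := by
  subst hK
  constructor
  · intro hx
    refine hx {x | ∃ f ∈ P, dist p x + dist x f = dist p f} ⟨⟨?_, ?_⟩, ?_⟩
    · obtain ⟨f, hf⟩ := hne
      exact ⟨f, f, hf, by simp⟩
    · rintro x ⟨f, hf, hxf⟩ y ⟨g, hg, hyg⟩ z hz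
      rcases between_or_of_between hX p hz with h | h
      · exact ⟨f, hf, between_trans h hxf⟩
      · exact ⟨g, hg, between_trans h hyg⟩
    · intro f hf
      exact ⟨f, hf, by simp⟩
  · rintro ⟨f, hf, hxf⟩ S hS
    exact hS.1.2 p (hp S hS) f (hS.2 hf) hxf

theorem subset_hull {P K : Set X} (hK : K = ⋂₀ {S : Set X | IsSubtree S ∧ P ⊆ S}) : P ⊆ K := by
  subst hK
  exact fun f hf S hS => hS.2 hf

/-- The gate of `z` is the point where the segment from `p` to `z` leaves `K`. As `K` is a finite
union of segments from `p`, this is the median of `p`, `z` and the `f ∈ P` with largest Gromov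
product. -/
theorem isGated_hull (hX : IsTreeMetric X) {P K : Set X} (hfin : P.Finite) (hne : P.Nonempty)
    (hK : K = ⋂₀ {S : Set X | IsSubtree S ∧ P ⊆ S}) : IsGated K := by
  intro z
  obtain ⟨p, hpP⟩ := hne
  have hp := subset_hull hK hpP
  obtain ⟨f, hf, hmax⟩ := hfin.exists_maximalFor (fun f => gp p z f) P ⟨p, hpP⟩
  have hmax' : ∀ g ∈ P, gp p z g ≤ gp p z f := fun g hg => by
    rcases le_total (gp p z g) (gp p z f) with h | h
    · exact h
    · exact hmax hg h
  obtain ⟨q, hq, hqz, hqf, -⟩ := exists_median hX p z f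
  refine ⟨q, (mem_hull_iff hX ⟨p, hpP⟩ hK hp q).2 ⟨f, hf, hqf⟩, fun k hk => ?_⟩
  obtain ⟨g, hg, hkg⟩ := (mem_hull_iff hX ⟨p, hpP⟩ hK hp k).1 hk
  have h1 : gp p z k ≤ gp p z f := by
    rw [gp_comm, gp_of_between hX hkg z, gp_comm]
    exact (min_le_right _ _).trans (by rw [gp_comm]; exact (gp_comm p g z ▸ hmax' g hg))
  have h2 := gp_of_between hX hqz k
  rw [hq, min_eq_right h1] at h2
  have h3 := dist_eq_sub_gp p z k
  have h4 := dist_eq_sub_gp p q k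
  rw [dist_comm z q]
  linarith

end FiniteSubtree

/-! ### Branch points -/

section Branch

variable {X : Type u} [MetricSpace X]

theorem connectedComponentIn_ne (hX : IsTreeMetric X) {c x y : X} (hy : y ≠ c)
    (h : gp c x y = 0) (hx : x ≠ c) :
    connectedComponentIn {c}ᶜ x ≠ connectedComponentIn {c}ᶜ y := by
  intro heq
  have h1 : y ∈ connectedComponentIn {c}ᶜ x := by
    rw [heq]; exact mem_connectedComponentIn hy
  have h2 := gp_pos_of_isPreconnected hX (isPreconnected_connectedComponentIn (x := x) (F := {c}ᶜ))
    (fun hc => connectedComponentIn_subset _ _ hc rfl) (mem_connectedComponentIn hx) h1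
  exact h2.ne' h

theorem three_le_encard {α : Type*} {s : Set α} {a b c : α} (ha : a ∈ s) (hb : b ∈ s) (hc : c ∈ s)
    (hab : a ≠ b) (hac : a ≠ c) (hbc : b ≠ c) : 3 ≤ s.encard := by
  rw [← Set.encard_eq_three.2 ⟨a, b, c, hab, hac, hbc, rfl⟩]
  refine Set.encard_le_encard ?_
  rintro d (rfl | rfl | rfl) <;> assumption

theorem isBranchPoint_of_gp (hX : IsTreeMetric X) {c x y z : X} (hx : x ≠ c) (hy : y ≠ c)
    (hz : z ≠ c) (hxy : gp c x y = 0) (hyz : gp c y z = 0) (hxz : gp c x z = 0) :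
    IsBranchPoint c :=
  three_le_encard ⟨x, hx, rfl⟩ ⟨y, hy, rfl⟩ ⟨z, hz, rfl⟩ (connectedComponentIn_ne hX hy hxy hx)
    (connectedComponentIn_ne hX hz hxz hx) (connectedComponentIn_ne hX hz hyz hy)

/-- A median of three points is one of them or a branch point. -/
theorem exists_median_branch (hX : IsTreeMetric X) (x y z : X) :
    ∃ c, dist x c = gp x y z ∧ dist x c + dist c y = dist x y ∧ dist x c + dist c z = dist x z ∧
      dist y c + dist c z = dist y z ∧ (c = x ∨ c = y ∨ c = z ∨ IsBranchPoint c) := by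
  obtain ⟨c, h1, h2, h3, h4⟩ := exists_median hX x y z
  refine ⟨c, h1, h2, h3, h4, ?_⟩
  by_contra! h
  exact h.2.2.2 (isBranchPoint_of_gp hX h.1.symm h.2.1.symm h.2.2.1.symm (gp_eq_zero_iff.2 h2)
    (gp_eq_zero_iff.2 h4) (gp_eq_zero_iff.2 h3))

variable {F : Type v} [Group F] [MulAction F X] [IsIsometricSMul F X]

theorem image_connectedComponentIn_smul (a : F) {q : X} (ha : a • q = q) {x : X} (hx : x ≠ q) :
    (fun y => a • y) '' connectedComponentIn {q}ᶜ x = connectedComponentIn {q}ᶜ (a • x) := by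
  have h := (Homeomorph.smul a : X ≃ₜ X).image_connectedComponentIn (s := {q}ᶜ) (x := x) hx
  have h2 : (Homeomorph.smul a : X ≃ₜ X) '' {q}ᶜ = {q}ᶜ := by
    rw [Set.image_compl_eq (Homeomorph.smul a).bijective, Set.image_singleton]
    congr 2
  rw [h2] at h
  exact h

/-- In the absence of inversions, an elliptic element moves a point by twice its distance to
a fixed point, which may be taken to be a branch point. -/
theorem exists_half_dist_of_fixed (hX : IsTreeMetric X) (hinv : HasNoInversions F X) {a : F} {q : X}
    (ha : a • q = q) (v : X) :
    ∃ c, (c = v ∨ IsBranchPoint c) ∧ dist v (a • v) = 2 * dist v c := by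
  obtain ⟨c, h1, h2, h3, h4, h5⟩ := exists_median_branch hX q v (a • v)
  have h6 : dist q (a • v) = dist q v := by conv_lhs => rw [← ha, dist_smul]
  have h7 : dist c v = dist c (a • v) := by linarith
  have h8 : dist v (a • v) = 2 * dist v c := by
    rw [← h4, ← h7, dist_comm c v]; ring
  by_cases hb : IsBranchPoint c
  · exact ⟨c, Or.inr hb, h8⟩
  by_cases hv : c = v
  · exact ⟨c, Or.inl hv, h8⟩
  -- What remains is that the segments from `q` to `v` and to `a • v` part at `q` itself; this
  -- yields an inversion.
  have hcq : c = q := by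
    rcases h5 with h | h | h | h
    · exact h
    · exact absurd h hv
    · rw [h, dist_self, ← h, dist_eq_zero] at h7
      exact absurd h7 hv
    · exact absurd h hb
  subst hcq
  exfalso
  have hv' : v ≠ c := fun h => hv h.symm
  have hav : ∀ {w : X}, w ≠ c → a • w ≠ c := fun hw h => hw (by
    rw [← ha] at h; exact (MulAction.injective a) h)
  set d₁ := connectedComponentIn {c}ᶜ v
  set d₂ := connectedComponentIn {c}ᶜ (a • v) with hd2
  have hd : d₁ ≠ d₂ := connectedComponentIn_ne hX (hav hv') (gp_eq_zero_iff.2 h4) hv'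
  have e1 : (fun y => a • y) '' d₁ = d₂ := image_connectedComponentIn_smul a ha hv'
  have e2 : (fun y => a • y) '' d₂ = connectedComponentIn {c}ᶜ (a • a • v) :=
    image_connectedComponentIn_smul a ha (hav hv')
  refine hinv ⟨a, c, hb, ha, d₁, ⟨v, hv', rfl⟩, d₂, ⟨_, hav hv', rfl⟩, hd, e1, ?_⟩
  -- If `a` did not take the second direction back to the first, its image would be a third
  -- direction at `c`.
  by_contra hne
  refine hb (three_le_encard ⟨v, hv', rfl⟩ ⟨_, hav hv', rfl⟩ ⟨_, hav (hav hv'), e2⟩ hd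
    (fun h => hne h.symm) fun h => ?_)
  have hinj : Function.Injective fun y : X => a • y := MulAction.injective a
  exact hd (hinj.image_injective (e1.trans h))

end Branch

/-! ### Translation lengths -/

section Axis

variable {X : Type u} [MetricSpace X] {F : Type v} [Group F] [MulAction F X] [IsIsometricSMul F X]

/-- The midpoint of a segment from `x` to `g • x` is moved by the powers of `g` along an axis, or
fixed. -/
theorem exists_axis_point (hX : IsTreeMetric X) (g : F) (x : X) :
    ∃ p, dist x p + dist p (g • x) = dist x (g • x) ∧
      (∀ n : ℕ, dist p (g ^ n • p) = n * dist p (g • p)) ∧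
      (dist p (g • p) = 0 ∨ dist p (g • p) = dist x (g • g • x) - dist x (g • x)) := by
  obtain ⟨p, hp1, hp2⟩ := hX.exists_between x (g • x) (dist x (g • x) / 2)
    (by positivity) (by linarith [dist_nonneg (x := x) (y := g • x)])
  refine ⟨p, by rw [hp1, hp2]; ring, ?_⟩
  rcases (dist_nonneg (x := p) (y := g • p)).eq_or_lt with h0 | hpos
  · refine ⟨fun n => ?_, Or.inl h0.symm⟩
    have hfix : g • p = p := (dist_eq_zero.1 h0.symm).symm
    have : g ^ n • p = p := by
      induction n with
      | zero => simp
      | succ n ih => rw [pow_succ, mul_smul, hfix, ih]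
    rw [this, dist_self, ← h0, mul_zero]
  have s1 : dist (g • x) (g • p) = dist x p := dist_smul g x p
  have s2 : dist (g • p) (g • g • x) = dist p (g • x) := dist_smul g p (g • x)
  have s3 : dist (g • x) (g • g • x) = dist x (g • x) := dist_smul g x (g • x)
  have s4 : dist (g • p) (g • g • p) = dist p (g • p) := dist_smul g p (g • p)
  have s5 : dist (g • g • p) (g • g • x) = dist x p := by rw [dist_smul, dist_smul, dist_comm]
  have c1 := dist_comm p (g • x)
  have c2 := dist_comm x p
  have c3 := dist_comm (g • p) p
  have c4 := dist_comm (g • p) (g • x)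
  have c5 := dist_comm x (g • x)
  have e0 : gp (g • p) (g • x) (g • g • x) = 0 := by unfold gp; linarith
  have e1 : 0 < gp (g • p) p (g • x) := by unfold gp; linarith
  have e2 : 0 < gp (g • p) (g • g • p) (g • g • x) := by
    have := dist_smul g (g • p) (g • x)
    unfold gp; linarith
  -- At `g • p`, the point `p` lies in the direction of `g • x`, and `g • g • p` in that of `g • g •
  -- x`; by `e0` these directions are opposite.
  have key : gp (g • p) p (g • g • p) = 0 := by
    refine le_antisymm ?_ (gp_nonneg _ _ _)
    rcases hX.hyp (g • p) (g • x) (g • g • p) (g • g • x) with h | h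
    · rcases hX.hyp (g • p) (g • x) p (g • g • p) with h' | h'
      · rw [gp_comm _ (g • x) p] at h'; linarith
      · linarith
    · linarith
  constructor
  · intro n
    -- At `g ^ (n + 1) • p` the points `p` and `g ^ n • p` lie in the same direction, and the next
    -- point lies opposite to the latter, hence also to `p`.
    have hstep : ∀ n : ℕ, dist p (g ^ n • p) = n * dist p (g • p) ∧
        dist p (g ^ (n + 1) • p) = (n + 1) * dist p (g • p) := by
      intro n
      induction n with
      | zero => simp
      | succ n ih =>
        have hn : dist (g ^ (n + 1) • p) (g ^ (n + 1 + 1) • p) = dist p (g • p) := by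
          rw [pow_succ g (n + 1), mul_smul, dist_smul]
        have hn' : dist (g ^ n • p) (g ^ (n + 1) • p) = dist p (g • p) := by
          rw [pow_succ g n, mul_smul, dist_smul]
        have hk : gp (g ^ (n + 1) • p) (g ^ n • p) (g ^ (n + 1 + 1) • p) = 0 := by
          rw [← key, ← gp_isometry (isometry_smul X (g ^ n)) (g • p)]
          simp only [pow_succ, mul_smul]
        have hpos' : 0 < gp (g ^ (n + 1) • p) p (g ^ n • p) := by
          unfold gp
          rw [dist_comm _ p, dist_comm _ (g ^ n • p), ih.1, ih.2, hn']
          linarith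
        have h0 : gp (g ^ (n + 1) • p) p (g ^ (n + 1 + 1) • p) = 0 := by
          refine le_antisymm ?_ (gp_nonneg _ _ _)
          rcases hX.hyp (g ^ (n + 1) • p) (g ^ n • p) p (g ^ (n + 1 + 1) • p) with h | h
          · rw [gp_comm] at h; linarith
          · linarith
        rw [gp_eq_zero_iff] at h0
        refine ⟨by push_cast; exact ih.2, ?_⟩
        rw [← h0, ih.2, hn]; push_cast; ring
    exact (hstep n).1
  · right
    -- The overlap of the segments from `g • x` to `x` and to `g • g • x` is computed by truncating
    -- at the midpoints `p` and `g • p`. These are distinct, so the overlap is shorter than half a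
    -- segment.
    have f1 := gp_of_between hX (e := g • x) (y := p) (f := x) (by linarith) (g • p)
    have f2 := gp_of_between hX (e := g • x) (y := g • p) (f := g • g • x) (by linarith) x
    have f3 : gp (g • x) p (g • p) = dist x (g • x) / 2 - dist p (g • p) / 2 := by
      unfold gp; linarith
    rw [gp_comm _ (g • p) x] at f2
    rw [f2, f3, gp_comm _ (g • g • x) x] at f1
    have f4 : dist (g • x) (g • p) = dist x (g • x) / 2 := by linarith
    have f5 : dist (g • x) p = dist x (g • x) / 2 := by linarith
    rw [f4, f5] at f1
    have f6 : gp (g • x) x (g • g • x) = dist x (g • x) / 2 - dist p (g • p) / 2 := by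
      rcases min_choice (dist x (g • x) / 2) (gp (g • x) x (g • g • x)) with h | h
      · rw [h, min_self] at f1; linarith
      · rw [h] at f1
        rcases min_choice (dist x (g • x) / 2) (gp (g • x) x (g • g • x)) with h' | h'
        · rw [h'] at f1; linarith
        · rw [h'] at f1; exact f1.symm
    unfold gp at f6
    linarith

/-- A point `x` moved less than `p` would make the distances from `p` to `g ^ n • p` grow too
slowly, since they exceed `n * dist x (g • x)` by at most `2 * dist p x`. -/
theorem translationLength_eq {g : F} {p : X}
    (hp : ∀ n : ℕ, dist p (g ^ n • p) = n * dist p (g • p)) :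
    translationLength X g = dist p (g • p) := by
  have : Nonempty X := ⟨p⟩
  refine le_antisymm (ciInf_le ⟨0, ?_⟩ p) (le_ciInf fun x => ?_)
  · rintro _ ⟨x, rfl⟩; exact dist_nonneg
  · by_contra! hlt
    obtain ⟨n, hn⟩ := exists_nat_gt (2 * dist p x / (dist p (g • p) - dist x (g • x)))
    rw [div_lt_iff₀ (by linarith)] at hn
    have h1 : ∀ n : ℕ, dist x (g ^ n • x) ≤ n * dist x (g • x) := by
      intro n
      induction n with
      | zero => simp
      | succ n ih =>
        have h2 := dist_triangle x (g ^ n • x) (g ^ (n + 1) • x)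
        have h3 : dist (g ^ n • x) (g ^ (n + 1) • x) = dist x (g • x) := by
          rw [pow_succ, mul_smul, dist_smul]
        push_cast; linarith
    have h2 := dist_triangle4 p x (g ^ n • x) (g ^ n • p)
    have h3 : dist (g ^ n • x) (g ^ n • p) = dist p x := by rw [dist_smul, dist_comm]
    have h4 := h1 n
    have h5 := hp n
    nlinarith

end Axis

/-! ### Trees without branch points -/

section Line

variable {X : Type u} [MetricSpace X]

/-- A tree without branch points embeds isometrically in the line. -/
theorem exists_isometry_real (hX : IsTreeMetric X) (hb : ∀ x : X, ¬ IsBranchPoint x) {u v : X}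
    (hvu : v ≠ u) :
    ∃ φ : X → ℝ, Isometry φ := by
  classical
  -- The signed distance from `u`, positive on the side of `v`.
  refine ⟨fun z => if gp u z v = 0 then -dist u z else dist u z, Isometry.of_dist_eq fun z w => ?_⟩
  have hcol : ∀ z w, gp u z w = 0 ∨ gp u z w = dist u z ∨ gp u z w = dist u w := by
    intro z w
    obtain ⟨c, h1, -, -, -, rfl | rfl | rfl | h⟩ := exists_median_branch hX u z w
    · left; rw [← h1, dist_self]
    · exact Or.inr (Or.inl h1.symm)
    · exact Or.inr (Or.inr h1.symm)
    · exact absurd h (hb c)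
  have hd := dist_eq_sub_gp u z w
  have hsame : gp u z w ≠ 0 → dist z w = |dist u z - dist u w| := by
    intro h0
    rcases (hcol z w).resolve_left h0 with h | h
    · have := h ▸ gp_le_right u z w
      rw [abs_of_nonpos (by linarith)]; linarith
    · have := h ▸ gp_le_left u z w
      rw [abs_of_nonneg (by linarith)]; linarith
  have hnn := gp_nonneg u z w
  have hopp : ∀ {z w : X}, gp u z v = 0 → gp u w v ≠ 0 → gp u z w = 0 := by
    intro z w h1 h2
    have h3 : 0 < gp u w v := lt_of_le_of_ne (gp_nonneg _ _ _) (Ne.symm h2)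
    rcases hX.hyp u z w v with h | h
    · exact le_antisymm (h1 ▸ h) (gp_nonneg _ _ _)
    · linarith
  have p1 := dist_nonneg (x := u) (y := z)
  have p2 := dist_nonneg (x := u) (y := w)
  by_cases hz : gp u z v = 0 <;> by_cases hw : gp u w v = 0
  · simp only [hz, hw, if_true, Real.dist_eq]
    have e : |(-dist u z) - (-dist u w)| = |dist u z - dist u w| := by
      rw [← abs_neg]; congr 1; ring
    rw [e]
    by_cases h0 : gp u z w = 0
    · by_cases hzu : z = u
      · subst hzu; rw [dist_self, zero_sub, abs_neg, abs_of_nonneg dist_nonneg]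
      by_cases hwu : w = u
      · subst hwu; rw [dist_self, sub_zero, abs_of_nonneg dist_nonneg, dist_comm]
      exact absurd (isBranchPoint_of_gp hX hzu hwu hvu h0 hw hz) (hb u)
    · exact (hsame h0).symm
  · simp only [hz, hw, if_true, if_false, Real.dist_eq]
    rw [hopp hz hw] at hd
    rw [abs_of_nonpos (by linarith)]; linarith
  · simp only [hz, hw, if_true, if_false, Real.dist_eq]
    rw [gp_comm, hopp hw hz] at hd
    rw [abs_of_nonneg (by linarith)]; linarith
  · simp only [hz, hw, if_false, Real.dist_eq]
    refine (hsame fun h0 => ?_).symm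
    have h3 : 0 < gp u w v := lt_of_le_of_ne (gp_nonneg _ _ _) (Ne.symm hw)
    have h4 : 0 < gp u z v := lt_of_le_of_ne (gp_nonneg _ _ _) (Ne.symm hz)
    rw [gp_comm] at h4
    rcases hX.hyp u z v w with h | h
    · rw [gp_comm] at h; linarith
    · rw [gp_comm] at h; linarith

variable {F : Type v} [Group F] [MulAction F X] [IsIsometricSMul F X]

/-- The image is convex, and the positive and negative powers of `g` move `p` arbitrarily far in
opposite directions. -/
theorem surjective_of_axis {φ : X → ℝ} (hX : IsTreeMetric X) (hφ : Isometry φ) {g : F} {p : X}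
    (hp : ∀ n : ℕ, dist p (g ^ n • p) = n * dist p (g • p)) (hpos : 0 < dist p (g • p)) :
    Function.Surjective φ := by
  have hφ' : ∀ z w, |φ z - φ w| = dist z w := fun z w => by rw [← Real.dist_eq, hφ.dist_eq]
  have hoc : ∀ z w t, φ z ≤ t → t ≤ φ w → ∃ c, φ c = t := by
    intro z w t h1 h2
    have h3 := hφ' z w
    rw [abs_of_nonpos (by linarith)] at h3
    obtain ⟨c, hc1, hc2⟩ := hX.exists_between z w (t - φ z) (by linarith) (by linarith)
    rw [← hφ'] at hc1 hc2
    refine ⟨c, ?_⟩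
    rcases abs_cases (φ z - φ c) with h | h <;> rcases abs_cases (φ c - φ w) with h' | h' <;>
      linarith
  intro t
  obtain ⟨n, hn⟩ := exists_nat_gt (|t - φ p| / dist p (g • p))
  rw [div_lt_iff₀ hpos] at hn
  have h1 := hp n
  have h2 : dist p ((g ^ n)⁻¹ • p) = n * dist p (g • p) := by
    rw [← h1, ← dist_smul (g ^ n), smul_inv_smul, dist_comm]
  have h3 : dist ((g ^ n)⁻¹ • p) (g ^ n • p) = 2 * (n * dist p (g • p)) := by
    rw [← dist_smul (g ^ n), smul_inv_smul, smul_smul, ← pow_add, hp]; push_cast; ring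
  rw [← hφ'] at h1 h2 h3
  set r := n * dist p (g • p)
  have h4 := abs_lt.1 hn
  have hr : 0 < r := (abs_nonneg _).trans_lt hn
  rcases abs_cases (φ p - φ (g ^ n • p)) with h | h <;>
    rcases abs_cases (φ p - φ ((g ^ n)⁻¹ • p)) with h' | h'
  · rcases abs_cases (φ ((g ^ n)⁻¹ • p) - φ (g ^ n • p)) with h'' | h'' <;> linarith
  · exact hoc (g ^ n • p) ((g ^ n)⁻¹ • p) t (by linarith) (by linarith)
  · exact hoc ((g ^ n)⁻¹ • p) (g ^ n • p) t (by linarith) (by linarith)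
  · rcases abs_cases (φ ((g ^ n)⁻¹ • p) - φ (g ^ n • p)) with h'' | h'' <;> linarith

/-- On a subset of the line, a nontrivial isometry with a fixed point is the reflection in it. The
product of reflections in distinct points is a translation without fixed points, so all centres
agree. -/
theorem exists_fixed_of_forall_fixed [Nonempty X] {φ : X → ℝ} (hφ : Isometry φ)
    (hfix : ∀ g : F, ∃ p : X, g • p = p) : ∃ p : X, ∀ g : F, g • p = p := by
  have hφ' : ∀ z w, |φ z - φ w| = dist z w := fun z w => by rw [← Real.dist_eq, hφ.dist_eq]
  have hrefl : ∀ (g : F) (p : X), g • p = p → (∃ z : X, g • z ≠ z) →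
      ∀ w, φ (g • w) = 2 * φ p - φ w := by
    rintro g p hp ⟨z, hz⟩ w
    have key : ∀ w, φ (g • w) = φ w ∨ φ (g • w) = 2 * φ p - φ w := by
      intro w
      have h1 : dist (g • w) p = dist w p := by conv_lhs => rw [← hp, dist_smul]
      rw [← hφ', ← hφ', abs_eq_abs] at h1
      rcases h1 with h | h
      · left; linarith
      · right; linarith
    rcases key w with h | h
    · have hzr := (key z).resolve_left fun h => hz (hφ.injective h)
      have h2 : dist (g • z) (g • w) = dist z w := dist_smul g z w
      rw [← hφ', ← hφ', hzr, h, abs_eq_abs] at h2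
      rcases h2 with h2 | h2
      · exact absurd (hφ.injective (by rw [hzr]; linarith)) hz
      · rw [h]; linarith
    · exact h
  by_cases htriv : ∀ (g : F) (z : X), g • z = z
  · exact ⟨Classical.arbitrary X, fun g => htriv g _⟩
  push Not at htriv
  obtain ⟨g, z, hz⟩ := htriv
  obtain ⟨p, hp⟩ := hfix g
  refine ⟨p, fun h => ?_⟩
  by_cases hh : ∃ z : X, h • z ≠ z
  · obtain ⟨q, hq⟩ := hfix h
    obtain ⟨r, hr⟩ := hfix (g * h)
    have h1 := hrefl g p hp ⟨z, hz⟩ (h • r)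
    rw [hrefl h q hq hh r, ← mul_smul, hr] at h1
    rwa [hφ.injective (show φ p = φ q by linarith)]
  · push Not at hh
    exact hh p

theorem exists_isBranchPoint (hX : IsTreeMetric X) [Nonempty X] (hline : ¬ Nonempty (X ≃ᵢ ℝ))
    (hnt : IsNontrivialAction F X) : ∃ x : X, IsBranchPoint x := by
  by_contra! hb
  have hv : ∃ u v : X, u ≠ v := by
    by_contra! h
    exact hnt ⟨Classical.arbitrary X, fun g => h _ _⟩
  obtain ⟨u, v, huv⟩ := hv
  obtain ⟨φ, hφ⟩ := exists_isometry_real hX hb huv.symm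
  refine hnt (exists_fixed_of_forall_fixed hφ fun g => ?_)
  obtain ⟨p, -, hp, -⟩ := exists_axis_point hX g u
  refine ⟨p, ?_⟩
  by_contra hne
  have hsurj := surjective_of_axis hX hφ hp (dist_pos.2 (Ne.symm hne))
  exact hline ⟨⟨Equiv.ofBijective φ ⟨hφ.injective, hsurj⟩, hφ⟩⟩

end Line

/-! ### The rank of the length group -/

section Rank

open TensorProduct

/-- A finitely generated group of real numbers generated modulo `2` by a finite set has rank at
most the cardinality of this set. -/
theorem toENat_rank_le {L Λ : AddSubgroup ℝ} (hL : L ≤ Λ) (hΛ : Λ.FG) (S : Finset ℝ)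
    (hS : ∀ r ∈ Λ, ∃ m ∈ AddSubgroup.closure (S : Set ℝ), ∃ c ∈ Λ, r = m + 2 * c) :
    Cardinal.toENat (Module.rank ℚ (ℚ ⊗[ℤ] L)) ≤ S.card := by
  have hfg : (AddSubgroup.toIntSubmodule Λ).FG := by
    rw [Submodule.fg_iff_addSubgroup_fg]; simpa using hΛ
  set M : Submodule ℤ ℝ := Submodule.span ℤ (S : Set ℝ) with hM
  have hMc : ∀ m ∈ AddSubgroup.closure (S : Set ℝ), m ∈ M := by
    intro m hm
    have : AddSubgroup.closure (S : Set ℝ) ≤ M.toAddSubgroup :=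
      (AddSubgroup.closure_le _).2 Submodule.subset_span
    exact this hm
  -- Nakayama's lemma for the ideal `(2)` and the image of `Λ` in `ℝ ⧸ M`: some odd, hence nonzero,
  -- `r` multiplies `Λ` into `M`. Multiplication by `r` then embeds `L` in `M`.
  obtain ⟨r, hr, hrM⟩ := Submodule.exists_sub_one_mem_and_smul_eq_zero_of_fg_of_le_smul
    (Ideal.span {(2 : ℤ)}) ((AddSubgroup.toIntSubmodule Λ).map M.mkQ) (hfg.map _) (by
      rintro _ ⟨x, hx, rfl⟩
      obtain ⟨m, hm, c, hc, rfl⟩ := hS x hx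
      have h1 : M.mkQ (m + 2 * c) = (2 : ℤ) • M.mkQ c := by
        rw [← map_smul, map_add, show M.mkQ m = 0 by simpa using hMc m hm, zero_add]
        congr 1
        simp
      rw [h1]
      exact Submodule.smul_mem_smul (Ideal.mem_span_singleton_self 2) ⟨c, hc, rfl⟩)
  have hr0 : r ≠ 0 := by
    rintro rfl
    rw [Ideal.mem_span_singleton] at hr
    omega
  have hrM' : ∀ x ∈ Λ, r • x ∈ M := by
    intro x hx
    have h1 := hrM (M.mkQ x) ⟨x, hx, rfl⟩
    rw [← map_smul] at h1
    simpa using h1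
  let f : L →ₗ[ℤ] M :=
    { toFun := fun x => ⟨r • (x : ℝ), hrM' _ (hL x.2)⟩
      map_add' := fun x y => by ext; simp
      map_smul' := fun n x => by ext; simp; ring }
  have hf : Function.Injective f := by
    intro x y hxy
    have h1 : r • (x : ℝ) = r • (y : ℝ) := congrArg Subtype.val hxy
    exact Subtype.ext (smul_right_injective ℝ hr0 h1)
  have hMfg : Module.Finite ℤ M := Module.Finite.span_of_finite ℤ S.finite_toSet
  have hMn : IsNoetherian ℤ M := isNoetherian_of_isNoetherianRing_of_finite ℤ M
  have hLfg : Module.Finite ℤ L := Module.Finite.of_injective f hf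
  have hLfree : Module.Free ℤ L := inferInstance
  rw [Cardinal.toENat_le_natCast, Module.rank_baseChange, Cardinal.lift_id]
  exact (LinearMap.rank_le_of_injective f hf).trans (rank_span_finset_le S)

end Rank

/-! ### Distances between branch points modulo 2. -/

section BranchGroup

variable {X : Type u} [MetricSpace X]

variable (X) in
/-- The group generated by the distances between branch points. -/
def branchGroup : AddSubgroup ℝ :=
  AddSubgroup.closure {r | ∃ v w : X, IsBranchPoint v ∧ IsBranchPoint w ∧ r = dist v w}

theorem dist_mem_branchGroup {v w : X} (hv : IsBranchPoint v) (hw : IsBranchPoint w) :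
    dist v w ∈ branchGroup X := AddSubgroup.subset_closure ⟨v, w, hv, hw, rfl⟩

/-- The defect in the triangle inequality is twice the distance from `w` to the median, which is
again a branch point. -/
theorem exists_dist_add_dist (hX : IsTreeMetric X) {v w u : X} (hv : IsBranchPoint v)
    (hw : IsBranchPoint w) (hu : IsBranchPoint u) :
    ∃ c ∈ branchGroup X, dist v u = dist v w + dist w u + 2 * c := by
  obtain ⟨c, h1, -, -, -, h⟩ := exists_median_branch hX w v u
  have hc : IsBranchPoint c := by rcases h with rfl | rfl | rfl | h <;> assumption
  refine ⟨-dist w c, neg_mem (dist_mem_branchGroup hw hc), ?_⟩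
  rw [h1, dist_eq_sub_gp w v u, dist_comm v w]; ring

variable {F : Type v} [Group F] [MulAction F X] [IsIsometricSMul F X]

theorem IsBranchPoint.smul {x : X} (hx : IsBranchPoint x) (g : F) : IsBranchPoint (g • x) := by
  have hinj : Function.Injective fun y : X => g • y := MulAction.injective g
  have hsub : (fun d : Set X => (fun y => g • y) '' d) '' directions x ⊆ directions (g • x) := by
    rintro _ ⟨_, ⟨y, hy, rfl⟩, rfl⟩
    refine ⟨g • y, fun h => hy (hinj h), ?_⟩
    have h := (Homeomorph.smul g : X ≃ₜ X).image_connectedComponentIn (s := {x}ᶜ) (x := y) hy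
    have h2 : (Homeomorph.smul g : X ≃ₜ X) '' {x}ᶜ = {g • x}ᶜ := by
      rw [Set.image_compl_eq (Homeomorph.smul g).bijective, Set.image_singleton]; rfl
    rw [h2] at h
    exact h
  have h3 := Set.encard_le_encard hsub
  rw [hinj.image_injective.encard_image] at h3
  exact le_trans hx h3

/-- Translation lengths are differences of distances between branch points. -/
theorem lengthGroup_le_branchGroup (hX : IsTreeMetric X) {x : X} (hx : IsBranchPoint x) :
    lengthGroup F X ≤ branchGroup X := by
  refine (AddSubgroup.closure_le _).2 ?_
  rintro _ ⟨g, rfl⟩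
  obtain ⟨p, -, hp, h⟩ := exists_axis_point hX g x
  change translationLength X g ∈ branchGroup X
  rw [translationLength_eq hp]
  rcases h with h | h
  · rw [h]; exact zero_mem _
  · rw [h]
    exact sub_mem (dist_mem_branchGroup hx ((hx.smul g).smul g))
      (dist_mem_branchGroup hx (hx.smul g))

/-- Distances between branch points are generated modulo `2` by the distances from a given branch
point to its images under group generators and to representatives of the other orbits. -/
theorem exists_eq_add_two_mul (hX : IsTreeMetric X) {v₀ : X} (hv₀ : IsBranchPoint v₀) {R : Set X}
    (horb : ∀ v : X, IsBranchPoint v → ∃ g : F, ∃ w ∈ R, v = g • w)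
    {E : Set F} (hE : Subgroup.closure E = ⊤) (M : AddSubgroup ℝ) (hMR : ∀ w ∈ R, dist v₀ w ∈ M)
    (hME : ∀ g ∈ E, ∃ m ∈ M, ∃ c ∈ branchGroup X, dist v₀ (g • v₀) = m + 2 * c)
    {r : ℝ} (hr : r ∈ branchGroup X) : ∃ m ∈ M, ∃ c ∈ branchGroup X, r = m + 2 * c := by
  let Q : AddSubgroup ℝ :=
    { carrier := {r | ∃ m ∈ M, ∃ c ∈ branchGroup X, r = m + 2 * c}
      zero_mem' := ⟨0, zero_mem _, 0, zero_mem _, by simp⟩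
      add_mem' := by
        rintro _ _ ⟨m, hm, c, hc, rfl⟩ ⟨m', hm', c', hc', rfl⟩
        exact ⟨m + m', add_mem hm hm', c + c', add_mem hc hc', by ring⟩
      neg_mem' := by
        rintro _ ⟨m, hm, c, hc, rfl⟩
        exact ⟨-m, neg_mem hm, -c, neg_mem hc, by ring⟩ }
  have hQM : ∀ m ∈ M, m ∈ Q := fun m hm => ⟨m, hm, 0, zero_mem _, by simp⟩
  have hQ2 : ∀ c ∈ branchGroup X, 2 * c ∈ Q := fun c hc => ⟨0, zero_mem _, c, hc, by simp⟩
  have htri : ∀ {v w u : X}, IsBranchPoint v → IsBranchPoint w → IsBranchPoint u →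
      dist v w ∈ Q → dist w u ∈ Q → dist v u ∈ Q := by
    intro v w u hv hw hu h1 h2
    obtain ⟨c, hc, h⟩ := exists_dist_add_dist hX hv hw hu
    rw [h]
    exact add_mem (add_mem h1 h2) (hQ2 c hc)
  -- Modulo twice the branch group, `g ↦ dist v₀ (g • v₀)` is additive, so generators suffice.
  have hgen : ∀ g : F, dist v₀ (g • v₀) ∈ Q := by
    intro g
    have hg : g ∈ Subgroup.closure E := hE ▸ Subgroup.mem_top g
    induction hg using Subgroup.closure_induction with
    | mem g hg => exact hME g hg
    | one => rw [one_smul, dist_self]; exact zero_mem _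
    | mul g h _ _ h1 h2 =>
      refine htri hv₀ (hv₀.smul g) (hv₀.smul _) h1 ?_
      rw [mul_smul, dist_smul]; exact h2
    | inv g _ h1 =>
      rwa [← dist_smul g, smul_inv_smul, dist_comm]
  have hQ : branchGroup X ≤ Q := by
    refine (AddSubgroup.closure_le _).2 ?_
    rintro _ ⟨v, w, hv, hw, rfl⟩
    have key : ∀ v, IsBranchPoint v → dist v₀ v ∈ Q := by
      intro v hv
      obtain ⟨g, w, hw, rfl⟩ := horb v hv
      refine htri hv₀ (hv₀.smul g) hv (hgen g) ?_
      rw [dist_smul]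
      exact hQM _ (hMR w hw)
    refine htri hv hv₀ hw ?_ (key w hw)
    rw [dist_comm]; exact key v hv
  exact hQ hr

end BranchGroup

/-! ### Points at distances from a finitely generated group -/

section CoordGroup

variable {X : Type u} [MetricSpace X]

/-- The group generated by half the distances between points of `V`. -/
def coordGroup (V : Set X) : AddSubgroup ℝ :=
  AddSubgroup.closure {r | ∃ v ∈ V, ∃ w ∈ V, r = dist v w / 2}

/-- The points of `K` whose distances to `V` lie in the coordinate group of `V`. -/
def coordSet (K V : Set X) : Set X := {x | x ∈ K ∧ ∀ v ∈ V, dist x v ∈ coordGroup V}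

theorem half_dist_mem {V : Set X} {v w : X} (hv : v ∈ V) (hw : w ∈ V) :
    dist v w / 2 ∈ coordGroup V := AddSubgroup.subset_closure ⟨v, hv, w, hw, rfl⟩

theorem dist_mem_coordGroup {V : Set X} {v w : X} (hv : v ∈ V) (hw : w ∈ V) :
    dist v w ∈ coordGroup V := by
  rw [← add_halves (dist v w)]
  exact add_mem (half_dist_mem hv hw) (half_dist_mem hv hw)

/-- This is the reason for the halves in `coordGroup`. -/
theorem gp_mem_coordGroup {V : Set X} {v w u : X} (hv : v ∈ V) (hw : w ∈ V) (hu : u ∈ V) :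
    gp v w u ∈ coordGroup V := by
  have : gp v w u = dist v w / 2 + dist v u / 2 - dist w u / 2 := by unfold gp; ring
  rw [this]
  exact sub_mem (add_mem (half_dist_mem hv hw) (half_dist_mem hv hu)) (half_dist_mem hw hu)

theorem coordGroup_fg {V : Set X} (hV : V.Finite) : (coordGroup V).FG := by
  refine (AddSubgroup.fg_iff _).2 ⟨_, rfl, ?_⟩
  refine ((hV.prod hV).image fun p => dist p.1 p.2 / 2).subset ?_
  rintro _ ⟨v, hv, w, hw, rfl⟩
  exact ⟨(v, w), ⟨hv, hw⟩, rfl⟩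

theorem min_mem_addSubgroup {A : AddSubgroup ℝ} {a b : ℝ} (ha : a ∈ A) (hb : b ∈ A) :
    min a b ∈ A := by
  rcases min_choice a b with h | h <;> rw [h] <;> assumption

theorem mem_coordSet_of_mem {K V : Set X} {v : X} (hv : v ∈ V) (hvK : v ∈ K) :
    v ∈ coordSet K V := ⟨hvK, fun _ hw => dist_mem_coordGroup hv hw⟩

theorem dist_mem_of_between (hX : IsTreeMetric X) {V : Set X} {e f y v : X} (he : e ∈ V)
    (hf : f ∈ V) (hv : v ∈ V) (hy : dist e y + dist y f = dist e f)
    (hey : dist e y ∈ coordGroup V) : dist y v ∈ coordGroup V := by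
  have h : gp e y v ∈ coordGroup V := by
    rw [gp_of_between hX hy]
    exact min_mem_addSubgroup hey (gp_mem_coordGroup he hf hv)
  rw [dist_eq_sub_gp e, two_mul]
  exact sub_mem (add_mem hey (dist_mem_coordGroup he hv)) (add_mem h h)

variable {P K V : Set X}

/-- A single base point suffices: `y` lies on a segment from `p` to a point of `P ⊆ V`, and its
position there determines its distances to `V` by minima of elements of the group. -/
theorem mem_coordSet_of_dist_mem (hX : IsTreeMetric X) (hne : P.Nonempty)
    (hK : K = ⋂₀ {S : Set X | IsSubtree S ∧ P ⊆ S}) (hPV : P ⊆ V) {p y : X} (hp : p ∈ V)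
    (hpK : p ∈ K) (hy : y ∈ K) (h : dist p y ∈ coordGroup V) : y ∈ coordSet K V := by
  obtain ⟨f, hf, hyf⟩ := (mem_hull_iff hX hne hK hpK y).1 hy
  exact ⟨hy, fun v hv => dist_mem_of_between hX hp (hPV hf) hv hyf h⟩

theorem dist_mem_of_mem_coordSet (hX : IsTreeMetric X) (hne : P.Nonempty)
    (hK : K = ⋂₀ {S : Set X | IsSubtree S ∧ P ⊆ S}) (hPV : P ⊆ V) {x y : X}
    (hx : x ∈ coordSet K V) (hy : y ∈ coordSet K V) : dist x y ∈ coordGroup V := by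
  obtain ⟨p, hpP⟩ := id hne
  have hpK := subset_hull hK hpP
  obtain ⟨f, hf, hxf⟩ := (mem_hull_iff hX hne hK hpK x).1 hx.1
  obtain ⟨g, hg, hyg⟩ := (mem_hull_iff hX hne hK hpK y).1 hy.1
  have h1 : dist p x ∈ coordGroup V := dist_comm x p ▸ hx.2 p (hPV hpP)
  have h2 : dist p y ∈ coordGroup V := dist_comm y p ▸ hy.2 p (hPV hpP)
  have h3 : gp p x y ∈ coordGroup V := by
    rw [gp_of_between hX hxf, gp_comm, gp_of_between hX hyg]
    exact min_mem_addSubgroup h1 (min_mem_addSubgroup h2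
      (gp_mem_coordGroup (hPV hpP) (hPV hg) (hPV hf)))
  rw [dist_eq_sub_gp p, two_mul]
  exact sub_mem (add_mem h1 h2) (add_mem h3 h3)

variable {F : Type v} [Group F] [MulAction F X] [IsIsometricSMul F X]

/-- The coordinate set is invariant under partial isometries with a common fixed point in `V`. -/
theorem smul_mem_coordSet_of_fixed (hX : IsTreeMetric X) (hne : P.Nonempty)
    (hK : K = ⋂₀ {S : Set X | IsSubtree S ∧ P ⊆ S}) (hPV : P ⊆ V) {p x : X} (hp : p ∈ V)
    (hpK : p ∈ K) {a : F} (ha : a • p = p) (hx : x ∈ coordSet K V) (hax : a • x ∈ K) :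
    a • x ∈ coordSet K V := by
  refine mem_coordSet_of_dist_mem hX hne hK hPV hp hpK hax ?_
  have : dist p (a • x) = dist x p := by rw [dist_comm]; conv_lhs => rw [← ha, dist_smul]
  rw [this]
  exact hx.2 p hp

/-- The coordinate set is invariant under the powers of an element with an axis through `V`. -/
theorem smul_mem_coordSet_of_axis (hX : IsTreeMetric X) (hne : P.Nonempty)
    (hK : K = ⋂₀ {S : Set X | IsSubtree S ∧ P ⊆ S}) (hPV : P ⊆ V) {p x : X} (hp : p ∈ V)
    (hpK : p ∈ K) {g : F} (haxis : ∀ n : ℕ, dist p (g ^ n • p) = n * dist p (g • p))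
    (hgp : g • p ∈ V) {N : ℕ} (hgN : g ^ N • p ∈ V)
    (hN : dist p (g • p) = 0 ∨ ∀ f ∈ P, dist p f ≤ N * dist p (g • p))
    (hx : x ∈ coordSet K V) (n : ℕ) (hnx : (g ^ n)⁻¹ • x ∈ K) :
    (g ^ n)⁻¹ • x ∈ coordSet K V := by
  refine mem_coordSet_of_dist_mem hX hne hK hPV hp hpK hnx ?_
  have h0 : dist p ((g ^ n)⁻¹ • x) = dist (g ^ n • p) x := by
    rw [← dist_smul (g ^ n), smul_inv_smul]
  rw [h0]
  have hxp : dist p x ∈ coordGroup V := dist_comm x p ▸ hx.2 p hp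
  rcases hN with hN | hN
  · have h1 := haxis n
    rw [hN, mul_zero, dist_eq_zero] at h1
    rwa [← h1]
  have hdist : ∀ m n : ℕ, m ≤ n →
      dist p (g ^ m • p) + dist (g ^ m • p) (g ^ n • p) = dist p (g ^ n • p) := by
    intro m n hmn
    obtain ⟨k, rfl⟩ := Nat.exists_eq_add_of_le hmn
    rw [pow_add, mul_smul, dist_smul, ← mul_smul, ← pow_add, haxis, haxis, haxis]
    push_cast; ring
  have hnl : dist p (g ^ n • p) ∈ coordGroup V := by
    rw [haxis, ← nsmul_eq_mul]
    exact nsmul_mem (dist_mem_coordGroup hp hgp) n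
  obtain ⟨f, hf, hxf⟩ := (mem_hull_iff hX hne hK hpK x).1 hx.1
  have hgpN : gp p (g ^ N • p) x ∈ coordGroup V := by
    rw [gp_comm, gp_of_between hX hxf]
    exact min_mem_addSubgroup hxp (gp_mem_coordGroup hp (hPV hf) hgN)
  -- For `n ≤ N` the product is a truncation of the one with `g ^ N • p`; for `n ≥ N` the two
  -- products agree, because `x` is no farther from `p` than `g ^ N • p`. Thus finitely many points
  -- of `V` serve all powers.
  have hgpn : gp p (g ^ n • p) x ∈ coordGroup V := by
    rcases le_total n N with h | h
    · rw [gp_of_between hX (hdist n N h)]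
      exact min_mem_addSubgroup hnl hgpN
    · have h1 := gp_of_between hX (hdist N n h) x
      have h2 := gp_le_right p (g ^ n • p) x
      have h3 := hN f hf
      rw [haxis, min_eq_right (by linarith [dist_nonneg (x := x) (y := f)])] at h1
      rwa [← h1]
  rw [dist_eq_sub_gp p, two_mul]
  exact sub_mem (add_mem hnl hxp) (add_mem hgpn hgpn)

/-- If the coordinate set contains its translates as far as they lie in `K`, then distances between
branch points belong to the coordinate group. -/
theorem branchGroup_le_coordGroup (hX : IsTreeMetric X) (hne : P.Nonempty) (hgated : IsGated K)
    (hK : K = ⋂₀ {S : Set X | IsSubtree S ∧ P ⊆ S}) (hPV : P ⊆ V)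
    (horb : ∀ v : X, IsBranchPoint v → ∃ g : F, ∃ w ∈ V ∩ K, v = g • w)
    (hinv : ∀ (g : F), ∀ x ∈ coordSet K V, g • x ∈ K → g • x ∈ coordSet K V)
    {E : Set F} (hE : Subgroup.closure E = ⊤)
    (hconn : ∀ g ∈ E, ∃ z ∈ coordSet K V, g • z ∈ coordSet K V) :
    branchGroup X ≤ coordGroup V := by
  have hstep : ∀ s : F, (∃ z ∈ coordSet K V, s • z ∈ coordSet K V) → ∀ g : F,
      (∀ x ∈ coordSet K V, ∀ y ∈ coordSet K V, dist x (g • y) ∈ coordGroup V) →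
      ∀ x ∈ coordSet K V, ∀ y ∈ coordSet K V, dist x ((s * g) • y) ∈ coordGroup V := by
    rintro s ⟨z, hz, hsz⟩ g ih x hx y hy
    have h1 : dist (s • z) ((s * g) • y) ∈ coordGroup V := by
      rw [mul_smul, dist_smul]; exact ih z hz y hy
    have h2 := dist_mem_of_mem_coordSet hX hne hK hPV hsz hx
    -- It suffices that the median is in the coordinate set. It lies in `K`, between `s • z` and
    -- `x`, and it is one of the three points or a branch point, hence a translate of a point of the
    -- coordinate set.
    obtain ⟨c, hc1, hc2, -, -, hc⟩ := exists_median_branch hX (s • z) x ((s * g) • y)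
    have hcK : c ∈ K := hgated.mem_of_between hsz.1 hx.1 hc2
    have hcD : c ∈ coordSet K V := by
      rcases hc with rfl | rfl | rfl | hc
      · exact hsz
      · exact hx
      · exact hinv _ y hy hcK
      · obtain ⟨h, w, hw, rfl⟩ := horb c hc
        exact hinv h w (mem_coordSet_of_mem hw.1 hw.2) hcK
    have h3 := dist_mem_of_mem_coordSet hX hne hK hPV hsz hcD
    rw [hc1] at h3
    rw [dist_eq_sub_gp (s • z), two_mul]
    exact sub_mem (add_mem h2 h1) (add_mem h3 h3)
  have key : ∀ g : F, ∀ x ∈ coordSet K V, ∀ y ∈ coordSet K V,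
      dist x (g • y) ∈ coordGroup V := by
    intro g
    have hg : g ∈ Subgroup.closure E := hE ▸ Subgroup.mem_top g
    induction hg using Subgroup.closure_induction_left with
    | one =>
      intro x hx y hy
      rw [one_smul]; exact dist_mem_of_mem_coordSet hX hne hK hPV hx hy
    | mul_left s hs g _ ih => exact hstep s (hconn s hs) g ih
    | inv_mul_cancel s hs g _ ih =>
      obtain ⟨z, hz, hsz⟩ := hconn s hs
      exact hstep s⁻¹ ⟨s • z, hsz, by rwa [inv_smul_smul]⟩ g ih
  refine (AddSubgroup.closure_le _).2 ?_
  rintro _ ⟨v, w, hv, hw, rfl⟩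
  obtain ⟨g, v, hv', rfl⟩ := horb v hv
  obtain ⟨h, w, hw', rfl⟩ := horb w hw
  have h1 := key (g⁻¹ * h) v (mem_coordSet_of_mem hv'.1 hv'.2) w
    (mem_coordSet_of_mem hw'.1 hw'.2)
  rwa [← dist_smul g, smul_smul, mul_inv_cancel_left] at h1

end CoordGroup

/-! ### The free product structure -/

section Blocks

open Monoid

variable {k m : ℕ} {s : Fin k → ℕ} {F : Type v} [Group F]

/-- The index set of the basis of a free factor: one of the `A_j`, or a cyclic factor of `B`. -/
def blockIndex (s : Fin k → ℕ) : Fin k ⊕ Fin m → Type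
  | .inl j => Fin (s j)
  | .inr _ => Unit

/-- The basis of a free factor. -/
def blockGen (e : FreeGroupBasis ((Σ j : Fin k, Fin (s j)) ⊕ Fin m) F) :
    (q : Fin k ⊕ Fin m) → blockIndex s q → F
  | .inl j, i => e (Sum.inl ⟨j, i⟩)
  | .inr i, _ => e (Sum.inr i)

/-- A free factor: one of the `A_j`, or a cyclic factor of `B`. -/
def block (e : FreeGroupBasis ((Σ j : Fin k, Fin (s j)) ⊕ Fin m) F) (q : Fin k ⊕ Fin m) :
    Subgroup F := (FreeGroup.lift (blockGen e q)).range

theorem block_inl (e : FreeGroupBasis ((Σ j : Fin k, Fin (s j)) ⊕ Fin m) F) (j : Fin k) :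
    block e (Sum.inl j) = factor e j := FreeGroup.range_lift_eq_closure

theorem block_inr (e : FreeGroupBasis ((Σ j : Fin k, Fin (s j)) ⊕ Fin m) F) (i : Fin m) :
    block e (Sum.inr i) = Subgroup.zpowers (e (Sum.inr i)) := by
  rw [Subgroup.zpowers_eq_closure]
  refine FreeGroup.range_lift_eq_closure.trans ?_
  congr 1
  exact Set.range_const (ι := Unit)

/-- The abstract free group on the basis of a free factor. -/
abbrev BlockGroup (s : Fin k → ℕ) (q : Fin k ⊕ Fin m) : Type := FreeGroup (blockIndex s q)

/-- The homomorphism from the free product of the factors. -/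
noncomputable def ofBlocks (e : FreeGroupBasis ((Σ j : Fin k, Fin (s j)) ⊕ Fin m) F) :
    CoprodI (BlockGroup (m := m) s) →* F :=
  CoprodI.lift fun q => FreeGroup.lift (blockGen e q)

/-- The homomorphism to the free product of the factors. -/
noncomputable def toBlocks (e : FreeGroupBasis ((Σ j : Fin k, Fin (s j)) ⊕ Fin m) F) :
    F →* CoprodI (BlockGroup (m := m) s) :=
  e.lift fun
    | .inl p => CoprodI.of (M := BlockGroup s) (i := Sum.inl p.1)
        (FreeGroup.of (show blockIndex s (Sum.inl p.1) from p.2))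
    | .inr i => CoprodI.of (M := BlockGroup s) (i := Sum.inr i)
        (FreeGroup.of (show blockIndex s (Sum.inr i) from ()))

theorem ofBlocks_of (e : FreeGroupBasis ((Σ j : Fin k, Fin (s j)) ⊕ Fin m) F) {q : Fin k ⊕ Fin m}
    (a : FreeGroup (blockIndex s q)) :
    ofBlocks e (CoprodI.of (M := BlockGroup s) a) = FreeGroup.lift (blockGen e q) a :=
  CoprodI.lift_of _ _

theorem toBlocks_blockGen (e : FreeGroupBasis ((Σ j : Fin k, Fin (s j)) ⊕ Fin m) F)
    (q : Fin k ⊕ Fin m) (i : blockIndex s q) :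
    toBlocks e (blockGen e q i) = CoprodI.of (M := BlockGroup s) (FreeGroup.of i) := by
  rcases q with j | j
  · change FreeGroup.lift _ (e.repr (e (Sum.inl ⟨j, i⟩))) = _
    rw [e.repr_apply_coe, FreeGroup.lift_apply_of]
  · change FreeGroup.lift _ (e.repr (e (Sum.inr j))) = _
    rw [e.repr_apply_coe, FreeGroup.lift_apply_of]
    rfl

theorem toBlocks_lift (e : FreeGroupBasis ((Σ j : Fin k, Fin (s j)) ⊕ Fin m) F) {q : Fin k ⊕ Fin m}
    (a : FreeGroup (blockIndex s q)) :
    toBlocks e (FreeGroup.lift (blockGen e q) a) = CoprodI.of (M := BlockGroup s) a := by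
  have h : (toBlocks e).comp (FreeGroup.lift (blockGen e q)) = CoprodI.of (M := BlockGroup s) := by
    refine FreeGroup.ext_hom _ _ fun i => ?_
    rw [MonoidHom.comp_apply, FreeGroup.lift_apply_of, toBlocks_blockGen]
  exact DFunLike.congr_fun h a

theorem closure_range_basis {I : Type*} (b : FreeGroupBasis I F) :
    Subgroup.closure (Set.range b) = ⊤ := by
  have h := congrArg (Subgroup.map b.repr.symm.toMonoidHom) (FreeGroup.closure_range_of I)
  rw [MonoidHom.map_closure, Subgroup.map_top_of_surjective _ b.repr.symm.surjective,
    ← Set.range_comp] at h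
  exact h

variable {T : Type u} [MetricSpace T] [MulAction F T] [IsIsometricSMul F T]

/-- In the tree of a system, points of `K` in the same orbit are related by chains of partial
isometries from the free factors. -/
theorem IsTreeOfSystem.smul_mem {e : FreeGroupBasis ((Σ j : Fin k, Fin (s j)) ⊕ Fin m) F}
    (hT : IsTreeMetric T) {K : Set T} (hK : IsGated K)
    (hsys : IsTreeOfSystem (systemElements e) K)
    (hconv : ∀ q, ∀ a ∈ block e q, ∀ b ∈ block e q, ∀ x ∈ K, ∀ y ∈ K, ∀ z,
      dist (a • x) z + dist z (b • y) = dist (a • x) (b • y) → ∃ c ∈ block e q, c • z ∈ K)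
    {D : Set T} (hD : ∀ q, ∀ a ∈ block e q, ∀ x ∈ D, a • x ∈ K → a • x ∈ D)
    {g : F} {x : T} (hx : x ∈ D) (hxK : x ∈ K) (hgx : g • x ∈ K) : g • x ∈ D := by
  let W := CoprodI (BlockGroup (m := m) s)
  let : MulAction W T := MulAction.compHom T (ofBlocks e)
  have hsm : ∀ (w : W) (x : T), w • x = ofBlocks e w • x := fun _ _ => rfl
  have : IsIsometricSMul W T := ⟨fun w => isometry_smul T (ofBlocks e w)⟩
  have hlift : ∀ {q} (a : FreeGroup (blockIndex s q)),
      FreeGroup.lift (blockGen e q) a ∈ block e q :=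
    fun a => ⟨a, rfl⟩
  obtain ⟨Y, m1, m2, m3, ι, hY, hι, hιs, hιD⟩ := exists_amalgam
    (G := BlockGroup (m := m) s) hT hK (by
      intro q a b x hx y hy z hz
      simp only [hsm, ofBlocks_of] at hz ⊢
      obtain ⟨_, ⟨c, rfl⟩, hc⟩ := hconv q _ (hlift a) _ (hlift b) x hx y hy z hz
      exact ⟨c, hc⟩)
  let : MulAction F Y := MulAction.compHom Y (toBlocks e)
  have hsmY : ∀ (g : F) (y : Y), g • y = toBlocks e g • y := fun _ _ => rfl
  have : IsIsometricSMul F Y := ⟨fun g => isometry_smul Y (toBlocks e g)⟩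
  -- Each element of the system lies in a single block, so it acts on the copy of `K` in `Y` as a
  -- letter does.
  have hreal : Realizes (systemElements e) K ι := by
    refine ⟨hι, fun g hg p q hpq => ?_⟩
    have hb : ∃ r, g ∈ block e r := by
      rcases hg with ⟨i, rfl⟩ | ⟨j, hj⟩
      · exact ⟨Sum.inr i, by rw [block_inr]; exact Subgroup.mem_zpowers _⟩
      · exact ⟨Sum.inl j, by rwa [block_inl]⟩
    obtain ⟨r, a, rfl⟩ := hb
    have := hιs r a p q (by rw [hsm, ofBlocks_of]; exact hpq)
    rw [hsmY]
    exact (congrArg (· • ι p) (toBlocks_lift e a)).trans this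
  -- The equivariant map carries the coincidence of `g • x` with a point of `K` over to `Y`, where
  -- it can only come from a chain.
  obtain ⟨f, ⟨-, hf, hfK⟩, -⟩ := hsys.2 Y (hY.isRTree ⟨ι ⟨x, hxK⟩⟩) ι hreal
  refine hιD D (fun q a x hx hax => ?_) (toBlocks e g) ⟨x, hxK⟩ ⟨g • x, hgx⟩ hx ?_
  · rw [hsm, ofBlocks_of] at hax ⊢
    exact hD q _ (hlift a) x hx hax
  · rw [← hfK, ← hfK, ← hsmY, ← hf]

/-- The translates of `K` by the powers of an element `g` with `K ∩ g K` nonempty have a convex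
union. -/
theorem exists_zpow_smul_mem (hT : IsTreeMetric T) {K : Set T} (hK : IsGated K) {g : F} {z₀ : T}
    (hz₀ : z₀ ∈ K) (hgz₀ : g • z₀ ∈ K) (i j : ℤ) {x y z : T} (hx : x ∈ K) (hy : y ∈ K)
    (hz : dist (g ^ i • x) z + dist z (g ^ j • y) = dist (g ^ i • x) (g ^ j • y)) :
    ∃ c ∈ Subgroup.zpowers g, c • z ∈ K := by
  have hnat : ∀ (n : ℕ) (x y z : T), x ∈ K → y ∈ K →
      dist x z + dist z (g ^ n • y) = dist x (g ^ n • y) →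
      ∃ c ∈ Subgroup.zpowers g, c • z ∈ K := by
    intro n
    induction n with
    | zero =>
      intro x y z hx hy hz
      rw [pow_zero, one_smul] at hz
      exact ⟨1, one_mem _, by rw [one_smul]; exact hK.mem_of_between hx hy hz⟩
    | succ n ih =>
      intro x y z hx hy hz
      -- The point `g • z₀` is common to `K` and its translate by `g`: `z` lies on a segment inside
      -- `K`, or, after translation by `g⁻¹`, on one with a smaller power.
      rcases between_or_of_between hT (g • z₀) hz with h | h
      · exact ⟨1, one_mem _, by rw [one_smul]; exact hK.mem_of_between hgz₀ hx h⟩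
      · obtain ⟨c, hc, hcz⟩ := ih z₀ y (g⁻¹ • z) hz₀ hy (by
          rw [← dist_smul g z₀, ← dist_smul g (g⁻¹ • z), ← dist_smul g z₀, smul_inv_smul, smul_smul,
            ← pow_succ']
          exact h)
        exact ⟨c * g⁻¹, mul_mem hc (inv_mem (Subgroup.mem_zpowers g)), by rwa [mul_smul]⟩
  have hle : ∀ (i j : ℤ) (x y z : T), i ≤ j → x ∈ K → y ∈ K →
      dist (g ^ i • x) z + dist z (g ^ j • y) = dist (g ^ i • x) (g ^ j • y) →
      ∃ c ∈ Subgroup.zpowers g, c • z ∈ K := by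
    intro i j x y z hij hx hy hz
    obtain ⟨n, hn⟩ := Int.eq_ofNat_of_zero_le (sub_nonneg.2 hij)
    obtain ⟨c, hc, hcz⟩ := hnat n x y (g ^ (-i) • z) hx hy (by
      rw [← dist_smul (g ^ i) x, ← dist_smul (g ^ i) (g ^ (-i) • z), ← dist_smul (g ^ i) x,
        smul_smul, smul_smul, ← zpow_add, ← zpow_natCast, ← zpow_add,
        show i + (n : ℤ) = j by omega, add_neg_cancel, zpow_zero, one_smul]
      exact hz)
    exact ⟨c * g ^ (-i), mul_mem hc (Subgroup.zpow_mem_zpowers g _), by rwa [mul_smul]⟩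
  rcases le_total i j with h | h
  · exact hle i j x y z h hx hy hz
  · refine hle j i y x z h hy hx ?_
    rw [dist_comm _ z, dist_comm z (g ^ i • x), add_comm, dist_comm (g ^ j • y)]
    exact hz

/-- The gate of `p` works: if `a • w = z` with `w, z ∈ K`, then the gate and its image under `a` lie
on the segment from `p` to `z` at the same distance from `p`. -/
theorem exists_fixed_mem (hT : IsTreeMetric T) {K : Set T} (hK : IsGated K) (H : Subgroup F)
    (hmeet : ∀ a ∈ H, (K ∩ (fun x => a • x) '' K).Nonempty) {p : T} (hp : ∀ a ∈ H, a • p = p) :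
    ∃ q ∈ K, ∀ a ∈ H, a • q = q := by
  refine ⟨hK.gate p, hK.gate_mem p, fun a ha => ?_⟩
  obtain ⟨z, hz, w, hw, hwz⟩ := hmeet a ha
  change a • w = z at hwz
  have h1 := hK.dist_eq p hz
  have h2 := hK.dist_eq p hw
  have hdist : ∀ y, dist p (a • y) = dist p y := fun y =>
    (congrArg (dist · (a • y)) (hp a ha).symm).trans (dist_smul a p y)
  have e1 := hdist (hK.gate p)
  have e2 := hdist w
  have e3 : dist (a • hK.gate p) (a • w) = dist (hK.gate p) w := dist_smul _ _ _
  rw [hwz] at e2 e3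
  exact eq_of_between hT (x := p) (y := z) (by linarith) h1.symm e1

/-- The translates of `K` by a free factor have a convex union. -/
theorem exists_block_smul_mem {e : FreeGroupBasis ((Σ j : Fin k, Fin (s j)) ⊕ Fin m) F}
    (hT : IsTreeMetric T) {K : Set T} (hK : IsGated K)
    (hmeet : ∀ g ∈ systemElements e, (K ∩ (fun x => g • x) '' K).Nonempty)
    (hell : ∀ j : Fin k, ∃ p : T, ∀ a ∈ factor e j, a • p = p) (q : Fin k ⊕ Fin m) :
    ∀ a ∈ block e q, ∀ b ∈ block e q, ∀ x ∈ K, ∀ y ∈ K, ∀ z,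
      dist (a • x) z + dist z (b • y) = dist (a • x) (b • y) → ∃ c ∈ block e q, c • z ∈ K := by
  rcases q with j | i
  · rw [block_inl]
    intro a ha b hb x hx y hy z hz
    obtain ⟨p, hp⟩ := hell j
    obtain ⟨q, hqK, hq⟩ := exists_fixed_mem hT hK _ (fun a ha => hmeet a (Or.inr ⟨j, ha⟩)) hp
    -- All translates of `K` by the factor contain the fixed point `q`, so their union is
    -- star-shaped about `q`.
    have key : ∀ a ∈ factor e j, ∀ x ∈ K, dist q z + dist z (a • x) = dist q (a • x) →
        a⁻¹ • z ∈ K := by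
      intro a ha x hx h
      refine hK.mem_of_between hqK hx ?_
      have h1 := hq a ha
      rw [← dist_smul a q, ← dist_smul a (a⁻¹ • z), ← dist_smul a q, smul_inv_smul, h1]
      exact h
    rcases between_or_of_between hT q hz with h | h
    · exact ⟨a⁻¹, inv_mem ha, key a ha x hx h⟩
    · exact ⟨b⁻¹, inv_mem hb, key b hb y hy h⟩
  · rw [block_inr]
    rintro _ ⟨n, rfl⟩ _ ⟨n', rfl⟩ x hx y hy z hz
    obtain ⟨w, hw, z₀, hz₀, rfl⟩ := hmeet _ (Or.inl ⟨i, rfl⟩)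
    exact exists_zpow_smul_mem hT hK hz₀ hw n n' hx hy hz

/-- For each free factor there is a finite set such that the coordinate set is invariant under the
factor and meets its translates by the generators of the factor. -/
theorem exists_block_coordSet {e : FreeGroupBasis ((Σ j : Fin k, Fin (s j)) ⊕ Fin m) F}
    (hT : IsTreeMetric T) {P K : Set T} (hfin : P.Finite) (hne : P.Nonempty)
    (hK : K = ⋂₀ {S : Set T | IsSubtree S ∧ P ⊆ S})
    (hmeet : ∀ g ∈ systemElements e, (K ∩ (fun x => g • x) '' K).Nonempty)
    (hell : ∀ j : Fin k, ∃ p : T, ∀ a ∈ factor e j, a • p = p) (q : Fin k ⊕ Fin m) :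
    ∃ V₀ : Set T, V₀.Finite ∧ ∀ V, P ⊆ V → V₀ ⊆ V →
      (∀ a ∈ block e q, ∀ x ∈ coordSet K V, a • x ∈ K → a • x ∈ coordSet K V) ∧
      ∀ i : blockIndex s q, ∃ z ∈ coordSet K V, blockGen e q i • z ∈ coordSet K V := by
  have hgated := isGated_hull hT hfin hne hK
  rcases q with j | i
  · obtain ⟨p, hp⟩ := hell j
    obtain ⟨q, hqK, hq⟩ := exists_fixed_mem hT hgated _ (fun a ha => hmeet a (Or.inr ⟨j, ha⟩)) hp
    refine ⟨{q}, Set.finite_singleton q, fun V hPV hV => ⟨fun a ha x hx hax => ?_, fun i => ?_⟩⟩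
    · rw [block_inl] at ha
      exact smul_mem_coordSet_of_fixed hT hne hK hPV (hV rfl) hqK (hq a ha) hx hax
    · have hqV := mem_coordSet_of_mem (hV rfl) hqK
      refine ⟨q, hqV, ?_⟩
      rwa [hq]
      exact Subgroup.subset_closure ⟨i, rfl⟩
  · obtain ⟨w, hw, z, hz, rfl⟩ := hmeet (e (Sum.inr i)) (Or.inl ⟨i, rfl⟩)
    set g := e (Sum.inr i) with hg
    simp only at hw
    obtain ⟨p, hp, haxis, -⟩ := exists_axis_point hT g z
    have hpK : p ∈ K := hgated.mem_of_between hz hw hp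
    have hginv : dist p (g⁻¹ • p) = dist p (g • p) := by
      rw [← dist_smul g, smul_inv_smul, dist_comm]
    have haxis' : ∀ n : ℕ, dist p (g⁻¹ ^ n • p) = n * dist p (g⁻¹ • p) := by
      intro n
      rw [hginv, ← haxis, inv_pow, ← dist_smul (g ^ n), smul_inv_smul, dist_comm]
    -- Either `g` fixes `p`, or `N` steps along the axis go at least as far from `p` as any point of
    -- `P`.
    obtain ⟨N, hN⟩ : ∃ N : ℕ, dist p (g • p) = 0 ∨ ∀ f ∈ P, dist p f ≤ N * dist p (g • p) := by
      rcases (dist_nonneg (x := p) (y := g • p)).eq_or_lt with h | h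
      · exact ⟨0, Or.inl h.symm⟩
      · obtain ⟨C, hC⟩ := (hfin.image fun f => dist p f).bddAbove
        obtain ⟨N, hN⟩ := exists_nat_ge (C / dist p (g • p))
        rw [div_le_iff₀ h] at hN
        exact ⟨N, Or.inr fun f hf => (hC ⟨f, hf, rfl⟩).trans hN⟩
    -- Axis points for both signs of the exponent, and the pair `z`, `g • z` showing that the
    -- coordinate set meets its translate.
    refine ⟨{p, g • p, g⁻¹ • p, g ^ N • p, g⁻¹ ^ N • p, z, g • z}, by simp, fun V hPV hV => ?_⟩
    simp only [Set.insert_subset_iff, Set.singleton_subset_iff] at hV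
    obtain ⟨v1, v2, v3, v4, v5, v6, v7⟩ := hV
    refine ⟨fun a ha x hx hax => ?_, fun _ =>
      ⟨z, mem_coordSet_of_mem v6 hz, mem_coordSet_of_mem v7 hw⟩⟩
    rw [block_inr] at ha
    obtain ⟨n, rfl⟩ := ha
    simp only at hax ⊢
    obtain ⟨n, rfl | rfl⟩ := n.eq_nat_or_neg
    · have h1 : g ^ (n : ℤ) = (g⁻¹ ^ n)⁻¹ := by rw [zpow_natCast, inv_pow, inv_inv]
      rw [← hg, h1] at hax ⊢
      exact smul_mem_coordSet_of_axis hT hne hK hPV v1 hpK haxis' v3 v5 (by rwa [hginv]) hx n hax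
    · have h1 : g ^ (-(n : ℤ)) = (g ^ n)⁻¹ := by rw [zpow_neg, zpow_natCast]
      rw [← hg, h1] at hax ⊢
      exact smul_mem_coordSet_of_axis hT hne hK hPV v1 hpK haxis v2 v4 hN hx n hax

/-- If there are finitely many orbits of branch points, the group generated by the distances
between branch points of a geometric tree is finitely generated. -/
theorem branchGroup_fg {e : FreeGroupBasis ((Σ j : Fin k, Fin (s j)) ⊕ Fin m) F}
    (hT : IsTreeMetric T) (hell : ∀ j : Fin k, ∃ p : T, ∀ a ∈ factor e j, a • p = p)
    (hgeo : IsGeometric T e) {R : Set T} (hR : R.Finite)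
    (horb : ∀ v : T, IsBranchPoint v → ∃ g : F, ∃ w ∈ R, v = g • w) : (branchGroup T).FG := by
  obtain ⟨K, ⟨P, hfin, hne, hK⟩, hmeet, hsys⟩ := hgeo
  have hgated := isGated_hull hT hfin hne hK
  choose V₀ hV₀ hblock using exists_block_coordSet hT hfin hne hK hmeet hell
  choose κ hκ using hsys.1
  -- The points spanning `K`, representatives of the branch orbits moved into `K`, and the finite
  -- sets required by the blocks.
  let V : Set T := P ∪ (fun w => κ w • w) '' R ∪ ⋃ q, V₀ q
  have hV : V.Finite := (hfin.union (hR.image _)).union (Set.finite_iUnion hV₀)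
  have hPV : P ⊆ V := fun x hx => Or.inl (Or.inl hx)
  have hV' : ∀ q, V₀ q ⊆ V := fun q x hx => Or.inr (Set.mem_iUnion.2 ⟨q, hx⟩)
  have hle : branchGroup T ≤ coordGroup V := by
    refine branchGroup_le_coordGroup (F := F) hT hne hgated hK hPV (fun v hv => ?_)
      (fun g x hx hgx => ?_) (E := {g | ∃ q i, g = blockGen e q i}) ?_ ?_
    · obtain ⟨g, w, hw, rfl⟩ := horb v hv
      exact ⟨g * (κ w)⁻¹, κ w • w, ⟨Or.inl (Or.inr ⟨w, hw, rfl⟩), hκ w⟩, by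
        rw [smul_smul, inv_mul_cancel_right]⟩
    · exact hsys.smul_mem hT hgated (exists_block_smul_mem hT hgated hmeet hell)
        (fun q => (hblock q V hPV (hV' q)).1) hx hx.1 hgx
    · rw [eq_top_iff, ← closure_range_basis e, Subgroup.closure_le]
      rintro _ ⟨p | i, rfl⟩
      · exact Subgroup.subset_closure ⟨Sum.inl p.1, p.2, rfl⟩
      · exact Subgroup.subset_closure ⟨Sum.inr i, (), rfl⟩
    · rintro _ ⟨q, i, rfl⟩
      exact (hblock q V hPV (hV' q)).2 i
  have h1 : (AddSubgroup.toIntSubmodule (coordGroup V)).FG := by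
    rw [Submodule.fg_iff_addSubgroup_fg]; simpa using coordGroup_fg hV
  have h3 : (AddSubgroup.toIntSubmodule (branchGroup T)).FG :=
    isNoetherian_submodule.1 (isNoetherian_of_fg_of_noetherian _ h1) _ hle
  rw [Submodule.fg_iff_addSubgroup_fg] at h3
  simpa using h3

end Blocks

/-! ### The bound on the rank -/

/-- A geometric tree with finitely many orbits of branch points: the rank of its length group is
bounded in terms of the number of these orbits. -/
theorem qRank_le {k m : ℕ} {s : Fin k → ℕ} {F : Type v} [Group F]
    (e : FreeGroupBasis ((Σ j : Fin k, Fin (s j)) ⊕ Fin m) F)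
    (T : Type u) [MetricSpace T] [MulAction F T] [IsIsometricSMul F T]
    (hT : IsRelativeTree T e) (hline : ¬ Nonempty (T ≃ᵢ ℝ))
    (hnontriv : IsNontrivialAction F T) (hinv : HasNoInversions F T)
    (hgeo : IsGeometric T e) (O : Finset (Set T))
    (hO : ∀ o, o ∈ O ↔ ∃ x : T, IsBranchPoint x ∧ o = MulAction.orbit F x) :
    qRank F T + 1 ≤ ((m + O.card : ℕ) : ℕ∞) := by
  classical
  have hX := hT.1.isTreeMetric
  have : Nonempty T := hT.1.1
  obtain ⟨x₀, hx₀⟩ := exists_isBranchPoint hX hline hnontriv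
  have hrep : ∀ o : Set T, ∃ x : T, o ∈ O → IsBranchPoint x ∧ o = MulAction.orbit F x := by
    intro o
    by_cases ho : o ∈ O
    · obtain ⟨x, hx⟩ := (hO o).1 ho
      exact ⟨x, fun _ => hx⟩
    · exact ⟨x₀, fun h => absurd h ho⟩
  choose rep hrep using hrep
  have ho₀ : MulAction.orbit F x₀ ∈ O := (hO _).2 ⟨x₀, hx₀, rfl⟩
  set o₀ := MulAction.orbit F x₀
  have hv₀ : IsBranchPoint (rep o₀) := (hrep o₀ ho₀).1
  have horb : ∀ v : T, IsBranchPoint v → ∃ g : F, ∃ w ∈ rep '' (O : Set (Set T)), v = g • w := by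
    intro v hv
    have ho : MulAction.orbit F v ∈ O := (hO _).2 ⟨v, hv, rfl⟩
    have h1 : v ∈ MulAction.orbit F (rep (MulAction.orbit F v)) := by
      rw [← (hrep _ ho).2]; exact MulAction.mem_orbit_self v
    obtain ⟨g, hg⟩ := h1
    exact ⟨g, _, ⟨_, ho, rfl⟩, hg.symm⟩
  -- One number for each orbit other than that of the base point, and one for each `x_i`; omitting
  -- the base orbit gives the `-1` of the bound.
  let S : Finset ℝ := (O.erase o₀).image (fun o => dist (rep o₀) (rep o)) ∪
    Finset.univ.image fun i : Fin m => dist (rep o₀) (e (Sum.inr i) • rep o₀)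
  have hS : S.card + 1 ≤ m + O.card := by
    have h1 : S.card ≤ (O.erase o₀).card + (Finset.univ : Finset (Fin m)).card :=
      (Finset.card_union_le _ _).trans (add_le_add Finset.card_image_le Finset.card_image_le)
    rw [Finset.card_erase_of_mem ho₀, Finset.card_univ, Fintype.card_fin] at h1
    have h2 := Finset.card_pos.2 ⟨o₀, ho₀⟩
    omega
  have hmod : ∀ r ∈ branchGroup T, ∃ c ∈ AddSubgroup.closure (S : Set ℝ),
      ∃ d ∈ branchGroup T, r = c + 2 * d := by
    intro r hr
    refine exists_eq_add_two_mul hX hv₀ horb (closure_range_basis e) _ ?_ ?_ hr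
    · rintro _ ⟨o, ho, rfl⟩
      by_cases h : o = o₀
      · rw [h, dist_self]; exact zero_mem _
      · exact AddSubgroup.subset_closure (Finset.mem_coe.2 (Finset.mem_union_left _
          (Finset.mem_image.2 ⟨o, Finset.mem_erase.2 ⟨h, ho⟩, rfl⟩)))
    · rintro _ ⟨⟨j, i⟩ | i, rfl⟩
      -- Basis elements of the `A_j` are elliptic and contribute zero modulo 2.
      · obtain ⟨p, hp⟩ := hT.2 j
        obtain ⟨c, hc, h⟩ := exists_half_dist_of_fixed hX hinv
          (hp (e (Sum.inl ⟨j, i⟩)) (Subgroup.subset_closure ⟨i, rfl⟩)) (rep o₀)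
        have hcb : IsBranchPoint c := by
          rcases hc with rfl | hc
          · exact hv₀
          · exact hc
        exact ⟨0, zero_mem _, _, dist_mem_branchGroup hv₀ hcb, by rw [h, zero_add]⟩
      · exact ⟨_, AddSubgroup.subset_closure (Finset.mem_coe.2 (Finset.mem_union_right _
          (Finset.mem_image.2 ⟨i, Finset.mem_univ i, rfl⟩))), 0, zero_mem _, by simp⟩
  have hrank := toENat_rank_le (lengthGroup_le_branchGroup (F := F) hX hx₀)
    (branchGroup_fg hX hT.2 hgeo (O.finite_toSet.image rep) horb) S hmod
  calc qRank F T + 1 ≤ (S.card : ℕ∞) + 1 := by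
        unfold qRank; gcongr
    _ = ((S.card + 1 : ℕ) : ℕ∞) := by push_cast; rfl
    _ ≤ ((m + O.card : ℕ) : ℕ∞) := by exact_mod_cast hS

end RelTree

theorem mainTheorem5 (n k : ℕ) (s : Fin k → ℕ) (hs : ∑ j, s j ≤ n)
    {F : Type v} [Group F]
    (e : FreeGroupBasis ((Σ j : Fin k, Fin (s j)) ⊕ Fin (n - ∑ j, s j)) F)
    (T : Type u) [MetricSpace T] [MulAction F T] [IsIsometricSMul F T]
    (hT : RelTree.IsRelativeTree T e)
    (hline : ¬ Nonempty (T ≃ᵢ ℝ))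
    (hnontriv : RelTree.IsNontrivialAction F T)
    (hmin : RelTree.IsMinimalAction F T)
    (hinv : RelTree.HasNoInversions F T)
    (hgeo : RelTree.IsGeometric T e) :
    RelTree.qRank F T + ((∑ j, s j : ℕ) : ℕ∞) + 1 ≤ (n : ℕ∞) + RelTree.numBranchOrbits F T := by
  by_cases hfin : {O : Set T | ∃ x : T, RelTree.IsBranchPoint x ∧ O = MulAction.orbit F x}.Finite
  · have h := RelTree.qRank_le e T hT hline hnontriv hinv hgeo hfin.toFinset
      fun o => hfin.mem_toFinset
    have hb : RelTree.numBranchOrbits F T = (hfin.toFinset.card : ℕ∞) :=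
      hfin.encard_eq_coe_toFinset_card
    rw [hb]
    calc RelTree.qRank F T + ((∑ j, s j : ℕ) : ℕ∞) + 1
        = (RelTree.qRank F T + 1) + ((∑ j, s j : ℕ) : ℕ∞) := by ring
      _ ≤ ((n - ∑ j, s j + hfin.toFinset.card : ℕ) : ℕ∞) + ((∑ j, s j : ℕ) : ℕ∞) := by gcongr
      _ = ((n + hfin.toFinset.card : ℕ) : ℕ∞) := by
        -- By `hs` the truncated subtraction is a genuine one.
        rw [← Nat.cast_add]; congr 1; omega
      _ = (n : ℕ∞) + (hfin.toFinset.card : ℕ∞) := by push_cast; rfl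
  · have hb : RelTree.numBranchOrbits F T = ⊤ := Set.encard_eq_top hfin
    rw [hb, add_top]
    exact le_top
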